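/- Let $\mu$ be a $\sigma$-finite positive measure on a set $X$ and let $L^2=L^2(X,\mu)$ be the complex Hilbert space. An operator $K$ on $L^2$ is a *positive kernel operator* if it maps a.e. nonnegative functions to a.e. nonnegative functions and there is a $\mu\times\mu$-measurable function $k$ on $X\times X$ (its kernel) such that for all $f\in L^2$ and almost all $x\in X$, $\int_X|k(x,y)f(y)|\,d\mu(y)<\infty$ and $(Kf)(x)=\int_X k(x,y)f(y)\,d\mu(y)$. (Such a $K$ is bounded, and $k\ge 0$ a.e.) For positive kernel operators $A,B$ with kernels $a,b$ and $\alpha\in[0,1]$, let $A^{(\alpha)}\circ B^{(1-\alpha)}$ denote the positive kernel operator with kernel $a(x,y)^{\alpha}\,b(x,y)^{1-\alpha}$ (with $0^0=1$). For sets $\Psi,\Phi$ of positive kernel operators let $$\Psi^{(\alpha)}\circ\Phi^{(1-\alpha)}=\{A^{(\alpha)}\circ B^{(1-\alpha)}:A\in\Psi,\ B\in\Phi\},\qquad \Psi^*=\{A^*:A\in\Psi\},$$ $$S_\alpha(\Psi)=\Psi^{(\alpha)}\circ(\Psi^*)^{(1-\alpha)}=\{A^{(\alpha)}\circ (B^*)^{(1-\alpha)}:A,B\in\Psi\},$$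 where $A^*$ is the Hilbert space adjoint. Products and sums of sets are elementwise: $\Psi_1\cdots\Psi_m=\{A_1\cdots A_m:A_i\in\Psi_i\}$ and $\Psi_1+\cdots+\Psi_m=\{A_1+\cdots+A_m:A_i\in\Psi_i\}$. For a bounded operator $A$ on $L^2$ let $\|A\|$ be the operator norm, let $w(A)=\sup\{|\langle Af,f\rangle|:\|f\|_2=1\}$ be the numerical radius, and let $\gamma(A)$ be the Hausdorff measure of non-compactness, i.e. the infimum of all $\delta>0$ for which there is a finite set $M\subset L^2$ with $A(D)\subset M+\delta D$, where $D$ is the closed unit ball of $L^2$. For a set $\Psi$ of bounded operators put $\|\Psi\|=\sup_{A\in\Psi}\|A\|$, $\gamma(\Psi)=\sup_{A\in\Psi}\gamma(A)$, $w(\Psi)=\sup_{A\in\Psi}w(A)$ (suprema in $[0,\infty]$, so the supremum over the empty set is $0$). **Corollary 3.2.** Let $m\ge 1$, let $\Psi_1,\ldots,\Psi_m$ be (norm-)bounded sets of positive kernel operators on $L^2(X,\mu)$, let $\alpha\in[0,1]$, and let $\rho\in\{\|\cdot\|,\gamma,w\}$. Then $$\rho\big(S_\alpha(\Psi_1)\cdots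 S_\alpha(\Psi_m)\big)\le\rho\Big((\Psi_1\cdots\Psi_m)^{(\alpha)}\circ\big((\Psi_m\cdots\Psi_1)^*\big)^{(1-\alpha)}\Big)\le\rho(\Psi_1\cdots\Psi_m)^{\alpha}\,\rho(\Psi_m\cdots\Psi_1)^{1-\alpha}$$ (with $0^0=1$) and $$\rho\big(S_\alpha(\Psi_1)+\cdots+S_\alpha(\Psi_m)\big)\le\rho\big(S_\alpha(\Psi_1+\cdots+\Psi_m)\big)\le\rho(\Psi_1+\cdots+\Psi_m).$$ -/

import Mathlib

open MeasureTheory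
open scoped Pointwise ENNReal NNReal ComplexOrder

section PositiveKernelOperators

variable {X : Type*} [MeasurableSpace X]

/-- Bounded linear operators on the complex Hilbert space `L²(X, μ)`. Multiplication is
composition. -/
abbrev L2Operator (μ : Measure X) : Type _ := Lp ℂ 2 μ →L[ℂ] Lp ℂ 2 μ

variable {μ : Measure X}

/-- `K` maps functions that are nonnegative a.e. to functions that are nonnegative a.e.
(for complex numbers, `0 ≤ z` means that `z` is real and nonnegative). This is positivity in the
sense of Banach lattices, not positive semidefiniteness. -/
def IsPositiveOperator (K : L2Operator μ) : Prop :=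
  ∀ f : Lp ℂ 2 μ, (∀ᵐ x ∂μ, 0 ≤ f x) → ∀ᵐ x ∂μ, 0 ≤ K f x

/-- `k` is a kernel of the operator `K`: `k` is `μ × μ`-measurable and, for every `f ∈ L²` and
almost every `x`, the function `y ↦ k (x, y) f y` is absolutely integrable with integral
`(K f) x`. -/
def HasKernel (K : L2Operator μ) (k : X × X → ℂ) : Prop :=
  AEStronglyMeasurable k (μ.prod μ) ∧
    ∀ f : Lp ℂ 2 μ, ∀ᵐ x ∂μ,
      Integrable (fun y => k (x, y) * f y) μ ∧ K f x = ∫ y, k (x, y) * f y ∂μ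

/-- A positive kernel operator on `L²(X, μ)`. -/
def IsPositiveKernelOperator (K : L2Operator μ) : Prop :=
  IsPositiveOperator K ∧ ∃ k : X × X → ℂ, HasKernel K k

/-- `C = A ^ (α) ∘ B ^ (1 - α)`, the Hadamard weighted geometric mean of `A` and `B`: the kernel
of `C` is `k ^ α * h ^ (1 - α)`, where `k` and `h` are the (a.e. nonnegative) kernels of `A` and
`B`. Here `0 ^ 0 = 1`, so that the mean is `A` for `α = 1` and `B` for `α = 0`. -/
def IsHadamardMean (α : ℝ) (A B C : L2Operator μ) : Prop :=
  ∃ k h : X × X → ℝ,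
    (∀ᵐ p ∂(μ.prod μ), 0 ≤ k p) ∧ (∀ᵐ p ∂(μ.prod μ), 0 ≤ h p) ∧
    HasKernel A (fun p => (k p : ℂ)) ∧ HasKernel B (fun p => (h p : ℂ)) ∧
    HasKernel C (fun p => ((k p ^ α * h p ^ (1 - α) : ℝ) : ℂ))

/-- The set `Ψ ^ (α) ∘ Φ ^ (1 - α) = {A ^ (α) ∘ B ^ (1 - α) : A ∈ Ψ, B ∈ Φ}`. -/
def hadamardMeanSet (α : ℝ) (Ψ Φ : Set (L2Operator μ)) : Set (L2Operator μ) :=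
  {C | ∃ A ∈ Ψ, ∃ B ∈ Φ, IsHadamardMean α A B C}

/-- The set `Ψ* = {A* : A ∈ Ψ}` of Hilbert space adjoints. -/
noncomputable def adjointSet (Ψ : Set (L2Operator μ)) : Set (L2Operator μ) :=
  (fun A => ContinuousLinearMap.adjoint A) '' Ψ

/-- The weighted geometric symmetrization
`S_α(Ψ) = Ψ ^ (α) ∘ (Ψ*) ^ (1 - α) = {A ^ (α) ∘ (B*) ^ (1 - α) : A, B ∈ Ψ}`. -/
noncomputable def geomSymm (α : ℝ) (Ψ : Set (L2Operator μ)) : Set (L2Operator μ) :=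
  hadamardMeanSet α Ψ (adjointSet Ψ)

/-- The Hausdorff measure of non-compactness of an operator: the infimum of all `δ > 0` such that
the image of the closed unit ball `D` is contained in `M + δ D` for some finite set `M`. -/
noncomputable def hausdorffNoncompactness (K : L2Operator μ) : ℝ≥0∞ :=
  sInf {d | ∃ δ : ℝ≥0, 0 < δ ∧ d = δ ∧ ∃ M : Set (Lp ℂ 2 μ), M.Finite ∧
    K '' Metric.closedBall 0 1 ⊆ M + (δ : ℝ) • Metric.closedBall (0 : Lp ℂ 2 μ) 1}

/-- The numerical radius of an operator, `sup {|⟨K f, f⟩| : ‖f‖ = 1}`. (Mathlib's inner product is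
linear in the second variable.) -/
noncomputable def numRadius (K : L2Operator μ) : ℝ≥0∞ :=
  ⨆ f : {f : Lp ℂ 2 μ // ‖f‖ = 1}, ‖inner ℂ (f : Lp ℂ 2 μ) (K f)‖ₑ

/-- `‖Ψ‖ = sup {‖A‖ : A ∈ Ψ}`. -/
noncomputable def setNorm (Ψ : Set (L2Operator μ)) : ℝ≥0∞ := ⨆ A ∈ Ψ, ‖A‖ₑ

/-- `γ(Ψ) = sup {γ(A) : A ∈ Ψ}`. -/
noncomputable def setNoncompactness (Ψ : Set (L2Operator μ)) : ℝ≥0∞ :=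
  ⨆ A ∈ Ψ, hausdorffNoncompactness A

/-- `w(Ψ) = sup {w(A) : A ∈ Ψ}`. -/
noncomputable def setNumRadius (Ψ : Set (L2Operator μ)) : ℝ≥0∞ := ⨆ A ∈ Ψ, numRadius A

/-- The product `Ψ_1 Ψ_2 ⋯ Ψ_m = {A_1 A_2 ⋯ A_m : A_i ∈ Ψ_i}`, in this order. -/
noncomputable def setProd {m : ℕ} (Ψ : Fin m → Set (L2Operator μ)) : Set (L2Operator μ) :=
  {A | ∃ a : Fin m → L2Operator μ, (∀ i, a i ∈ Ψ i) ∧ A = (List.ofFn a).prod}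

/-- The sum `Ψ_1 + ⋯ + Ψ_m = {A_1 + ⋯ + A_m : A_i ∈ Ψ_i}`. -/
def setSum {m : ℕ} (Ψ : Fin m → Set (L2Operator μ)) : Set (L2Operator μ) :=
  {A | ∃ a : Fin m → L2Operator μ, (∀ i, a i ∈ Ψ i) ∧ A = ∑ i, a i}

end PositiveKernelOperators

/-!
All inequalities rest on one relation between three kernel operators: `C`, `A`, `B` have kernels
with `c ≤ a ^ α * b ^ (1 - α)` pointwise (`IsGeomDominated`). By Hölder's inequality it is preserved
by products and sums of operators (`IsGeomDominated.mul`, `IsGeomDominated.add`), so a product or sum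
of Hadamard means is dominated, kernel by kernel, by the Hadamard mean of the products or sums,
which exists because its kernel is at most the sum of the two given kernels
(`IsGeomDominated.exists_isHadamardMean`). It therefore suffices that each of the three
functionals `r` is invariant under adjoints and satisfies `r C ≤ r A ^ α * r B ^ (1 - α)` whenever
the relation holds; the case `A = B` is monotonicity of `r` with respect to kernels.

For the norm and the numerical radius, the inequality follows by applying Hölder's inequality to the
form `∬ κ(x, y) |f(y)| |g(x)| dμ dμ`, because `|⟨Cf, g⟩|` is at most the form of `c`, while the
forms of `a` and `b` are `⟨A|f|, |g|⟩` and `⟨B|f|, |g|⟩`. The same argument applies to functions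
`f` supported in a fixed set `E` (`IsGeomDominated.enorm_apply_le`).

The measure of non-compactness `γ` is reduced to such norms: if `w > 0` is in `L²`, then `γ(T)` is
the limit, as `∫_E w² dμ → 0`, of the norm of `T` on the functions supported in `E`. That this
limit is at most `γ(T)` holds for every bounded operator, since the pairings of such functions with
finitely many fixed elements of `L²` tend to zero
(`exists_pos_enorm_apply_le_of_hausdorffNoncompactness_lt`). The converse
(`HasENNRealKernel.hausdorffNoncompactness_le`) uses that kernel operators map order intervals to
totally bounded sets (`HasENNRealKernel.isAMCompact`): this is clear for operators of rank one, and
it passes to indicator functions of measurable sets by the `π`-`λ` theorem and then to all kernels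
by dominated convergence. Finally, `γ(T*) = γ(T)` by projecting onto the span of a finite net.
-/

section Kernels

variable {X : Type*} [MeasurableSpace X] {μ : Measure X}

/-! ### Moduli of functions in `L²` -/

/-- The modulus `|f|` of `f ∈ L²(X, μ)`, as an element of the complex `L²(X, μ)`. -/
noncomputable def absLp (f : Lp ℂ 2 μ) : Lp ℂ 2 μ :=
  ((Lp.memLp f).norm.ofReal (K := ℂ)).toLp

theorem coeFn_absLp (f : Lp ℂ 2 μ) : ∀ᵐ x ∂μ, absLp f x = (‖f x‖ : ℂ) :=
  MemLp.coeFn_toLp _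

theorem enorm_absLp_apply (f : Lp ℂ 2 μ) : ∀ᵐ x ∂μ, ‖absLp f x‖ₑ = ‖f x‖ₑ := by
  filter_upwards [coeFn_absLp f] with x hx
  rw [hx, ← ofReal_norm, ← ofReal_norm]
  simp

theorem norm_absLp (f : Lp ℂ 2 μ) : ‖absLp f‖ = ‖f‖ := by
  apply le_antisymm <;> refine Lp.norm_le_norm_of_ae_le ?_ <;>
    filter_upwards [coeFn_absLp f] with x hx <;> simp [hx]

@[fun_prop]
theorem measurable_coeFn_Lp (f : Lp ℂ 2 μ) : Measurable (f : X → ℂ) :=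
  (Lp.stronglyMeasurable f).measurable

/-- On a `σ`-finite measure space there is a strictly positive function in `L²`. -/
theorem exists_pos_lintegral_sq_lt_top (μ : Measure X) [SigmaFinite μ] :
    ∃ w : X → ℝ≥0, (∀ x, 0 < w x) ∧ Measurable w ∧ ∫⁻ x, (w x : ℝ≥0∞) ^ 2 ∂μ < ∞ := by
  obtain ⟨g, h0, hm, hi⟩ := exists_pos_lintegral_lt_of_sigmaFinite μ (ε := 1) one_ne_zero
  refine ⟨fun x => NNReal.sqrt (g x), fun x => by simpa using h0 x, by fun_prop, ?_⟩
  refine lt_of_le_of_lt (lintegral_mono fun x => ?_) (hi.trans ENNReal.one_lt_top)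
  simp [← ENNReal.coe_pow]

theorem memLp_two_of_lintegral_sq_lt_top {w : X → ℝ≥0} (hw : Measurable w)
    (h : ∫⁻ x, (w x : ℝ≥0∞) ^ 2 ∂μ < ∞) : MemLp (fun x => ((w x : ℝ) : ℂ)) 2 μ := by
  refine ⟨by fun_prop, ?_⟩
  rw [eLpNorm_lt_top_iff_lintegral_rpow_enorm_lt_top (by simp) (by simp)]
  refine lt_of_le_of_lt (lintegral_mono fun x => ?_) h
  rw [← ofReal_norm]
  simp

/-! ### Operators with `[0, ∞]`-valued kernels -/

/-- The operator `T` is given by the measurable kernel `κ` with values in `[0, ∞]`: for every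
`f ∈ L²`, almost every `x` satisfies `∫ κ(x, y) |f(y)| dμ(y) < ∞` and
`(T f)(x) = ∫ κ(x, y) f(y) dμ(y)`. Values `∞` of `κ`, allowed so that compositions of kernels need
no corrections, occur on a null set only. -/
def HasENNRealKernel (T : L2Operator μ) (κ : X → X → ℝ≥0∞) : Prop :=
  Measurable (Function.uncurry κ) ∧ ∀ f : Lp ℂ 2 μ, ∀ᵐ x ∂μ,
    ∫⁻ y, κ x y * ‖f y‖ₑ ∂μ < ∞ ∧ T f x = ∫ y, ((κ x y).toReal : ℂ) * f y ∂μ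

theorem measurable_kernel_lintegral [SFinite μ] {κ : X → X → ℝ≥0∞}
    (hκ : Measurable (Function.uncurry κ)) {f : X → ℂ} (hf : Measurable f) :
    Measurable fun x => ∫⁻ y, κ x y * ‖f y‖ₑ ∂μ := by
  apply Measurable.lintegral_prod_right
  have : Measurable fun p : X × X => κ p.1 p.2 := hκ
  simp only [Function.uncurry_def]
  fun_prop

theorem measurable_kernel_section {κ : X → X → ℝ≥0∞}
    (hκ : Measurable (Function.uncurry κ)) (x : X) : Measurable (κ x) :=
  hκ.comp (measurable_const.prodMk measurable_id)

theorem enorm_toReal_mul_le (c : ℝ≥0∞) (z : ℂ) : ‖(c.toReal : ℂ) * z‖ₑ ≤ c * ‖z‖ₑ := by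
  rw [enorm_mul]
  gcongr
  rw [← ofReal_norm]
  simpa using ENNReal.ofReal_toReal_le

theorem integrable_toReal_kernel {κ : X → X → ℝ≥0∞} (hκ : Measurable (Function.uncurry κ))
    (f : Lp ℂ 2 μ) {x : X} (h : ∫⁻ y, κ x y * ‖f y‖ₑ ∂μ < ∞) :
    Integrable (fun y => ((κ x y).toReal : ℂ) * f y) μ := by
  have := measurable_kernel_section hκ x
  refine ⟨by fun_prop, lt_of_le_of_lt (lintegral_mono fun y => enorm_toReal_mul_le _ _) h⟩

theorem measurable_kernel_comp [SFinite μ] {κ η : X → X → ℝ≥0∞}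
    (hκ : Measurable (Function.uncurry κ)) (hη : Measurable (Function.uncurry η)) :
    Measurable (Function.uncurry fun x y => ∫⁻ z, κ x z * η z y ∂μ) := by
  apply Measurable.lintegral_prod_right
  exact (hκ.comp ((measurable_fst.comp measurable_fst).prodMk measurable_snd)).mul
    (hη.comp (measurable_snd.prodMk (measurable_snd.comp measurable_fst)))

theorem lintegral_kernel_comp [SFinite μ] {u : X → ℝ≥0∞} {η : X → X → ℝ≥0∞} {f : X → ℂ}
    (hu : Measurable u) (hη : Measurable (Function.uncurry η)) (hf : Measurable f) :
    ∫⁻ y, (∫⁻ z, u z * η z y ∂μ) * ‖f y‖ₑ ∂μ = ∫⁻ z, u z * ∫⁻ y, η z y * ‖f y‖ₑ ∂μ ∂μ := by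
  have hmeas : Measurable (Function.uncurry fun z y => u z * η z y * ‖f y‖ₑ) :=
    ((hu.comp measurable_fst).mul hη).mul (hf.enorm.comp measurable_snd)
  have my : ∀ y, Measurable fun z => u z * η z y := fun y =>
    hu.mul (hη.comp (measurable_id.prodMk measurable_const))
  have h1 : ∀ z, u z * ∫⁻ y, η z y * ‖f y‖ₑ ∂μ = ∫⁻ y, u z * η z y * ‖f y‖ₑ ∂μ := fun z => by
    have := measurable_kernel_section hη z
    simp only [mul_assoc]
    rw [lintegral_const_mul _ (by fun_prop)]
  have h2 : ∀ y, (∫⁻ z, u z * η z y ∂μ) * ‖f y‖ₑ = ∫⁻ z, u z * η z y * ‖f y‖ₑ ∂μ :=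
    fun y => (lintegral_mul_const _ (my y)).symm
  simp only [h1, h2]
  exact (lintegral_lintegral_swap hmeas.aemeasurable).symm

theorem integral_kernel_comp [SigmaFinite μ] {u : X → ℝ≥0∞} {η : X → X → ℝ≥0∞} {f : X → ℂ}
    (hu : Measurable u) (hη : Measurable (Function.uncurry η)) (hf : Measurable f)
    (hu' : ∀ᵐ z ∂μ, u z < ∞) (hη' : ∀ᵐ z ∂μ, ∀ᵐ y ∂μ, η z y < ∞)
    (h : ∫⁻ z, u z * ∫⁻ y, η z y * ‖f y‖ₑ ∂μ ∂μ < ∞) :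
    ∫ z, ((u z).toReal : ℂ) * ∫ y, ((η z y).toReal : ℂ) * f y ∂μ ∂μ =
      ∫ y, ((∫⁻ z, u z * η z y ∂μ).toReal : ℂ) * f y ∂μ := by
  have hswap : ∀ᵐ y ∂μ, ∀ᵐ z ∂μ, η z y < ∞ :=
    (Measure.ae_ae_comm (p := fun z y => η z y < ∞)
      (measurableSet_lt hη measurable_const)).1 hη'
  have my : ∀ y, Measurable fun z => u z * η z y := fun y =>
    hu.mul (hη.comp (measurable_id.prodMk measurable_const))
  have hint : Integrable (Function.uncurry fun z y =>
      ((u z).toReal : ℂ) * (((η z y).toReal : ℂ) * f y)) (μ.prod μ) := by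
    have hmeas : Measurable fun p : X × X => u p.1 * (η p.1 p.2 * ‖f p.2‖ₑ) :=
      (hu.comp measurable_fst).mul (hη.mul (hf.enorm.comp measurable_snd))
    refine ⟨Measurable.aestronglyMeasurable ?_, ?_⟩
    · exact (Complex.measurable_ofReal.comp (hu.comp measurable_fst).ennreal_toReal).mul
        ((Complex.measurable_ofReal.comp hη.ennreal_toReal).mul (hf.comp measurable_snd))
    · refine lt_of_le_of_lt (lintegral_mono (g := fun p => u p.1 * (η p.1 p.2 * ‖f p.2‖ₑ))
        fun p => (enorm_toReal_mul_le _ _).trans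
          (mul_le_mul_right (enorm_toReal_mul_le _ _) _)) ?_
      rw [lintegral_prod _ hmeas.aemeasurable]
      refine lt_of_le_of_lt (lintegral_mono fun z => ?_) h
      have := measurable_kernel_section hη z
      exact (lintegral_const_mul _ (by fun_prop)).le
  simp only [← integral_const_mul]
  rw [integral_integral_swap hint]
  refine integral_congr_ae ?_
  filter_upwards [hswap] with y hy
  simp only [← mul_assoc]
  rw [integral_mul_const]
  congr 1
  rw [← integral_toReal (my y).aemeasurable
    (by filter_upwards [hy, hu'] with z a b using ENNReal.mul_lt_top b a),
    ← integral_complex_ofReal]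
  simp [ENNReal.toReal_mul]

namespace HasENNRealKernel

variable {T S : L2Operator μ} {κ η : X → X → ℝ≥0∞}

theorem enorm_apply_le (hT : HasENNRealKernel T κ) (f : Lp ℂ 2 μ) :
    ∀ᵐ x ∂μ, ‖T f x‖ₑ ≤ ∫⁻ y, κ x y * ‖f y‖ₑ ∂μ := by
  filter_upwards [hT.2 f] with x hx
  rw [hx.2]
  exact (enorm_integral_le_lintegral_enorm _).trans
    (lintegral_mono fun y => enorm_toReal_mul_le _ _)

theorem ae_ae_lt_top [SigmaFinite μ] (hT : HasENNRealKernel T κ) :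
    ∀ᵐ x ∂μ, ∀ᵐ y ∂μ, κ x y < ∞ := by
  obtain ⟨w, h0, hm, hi⟩ := exists_pos_lintegral_sq_lt_top μ
  set f := (memLp_two_of_lintegral_sq_lt_top hm hi).toLp
  filter_upwards [hT.2 f] with x hx
  have h1 := measurable_kernel_section hT.1 x
  filter_upwards [ae_lt_top (by fun_prop) hx.1.ne,
    (memLp_two_of_lintegral_sq_lt_top hm hi).coeFn_toLp] with y hy hfy
  refine lt_of_not_ge fun h => hy.ne ?_
  rw [top_le_iff.1 h, ENNReal.top_mul]
  rw [hfy]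
  simpa using (h0 y).ne'

theorem apply_absLp [SigmaFinite μ] (hT : HasENNRealKernel T κ) (f : Lp ℂ 2 μ) :
    ∀ᵐ x ∂μ, ∫⁻ y, κ x y * ‖f y‖ₑ ∂μ < ∞ ∧
      T (absLp f) x = ((∫⁻ y, κ x y * ‖f y‖ₑ ∂μ).toReal : ℂ) := by
  filter_upwards [hT.2 (absLp f), hT.2 f, hT.ae_ae_lt_top] with x hx hfx htop
  refine ⟨hfx.1, ?_⟩
  have h1 := measurable_kernel_section hT.1 x
  rw [hx.2, ← integral_toReal (by fun_prop) (by filter_upwards [htop] with y hy; finiteness),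
    ← integral_complex_ofReal]
  refine integral_congr_ae ?_
  filter_upwards [coeFn_absLp f] with y hy
  rw [hy, ENNReal.toReal_mul]
  simp

theorem enorm_apply_absLp [SigmaFinite μ] (hT : HasENNRealKernel T κ) (f : Lp ℂ 2 μ) :
    ∀ᵐ x ∂μ, ‖T (absLp f) x‖ₑ = ∫⁻ y, κ x y * ‖f y‖ₑ ∂μ := by
  filter_upwards [hT.apply_absLp f] with x hx
  rw [hx.2, ← ofReal_norm]
  simp [ENNReal.ofReal_toReal hx.1.ne]

theorem unique (hT : HasENNRealKernel T κ) (hS : HasENNRealKernel S κ) : T = S := by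
  ext1 f
  refine Lp.ext ?_
  filter_upwards [hT.2 f, hS.2 f] with x h1 h2
  rw [h1.2, h2.2]

theorem zero : HasENNRealKernel (0 : L2Operator μ) fun _ _ => 0 := by
  refine ⟨measurable_const, fun f => ?_⟩
  filter_upwards [Lp.coeFn_zero ℂ 2 μ] with x hx
  simpa using hx

theorem add [SigmaFinite μ] (hT : HasENNRealKernel T κ) (hS : HasENNRealKernel S η) :
    HasENNRealKernel (T + S) fun x y => κ x y + η x y := by
  refine ⟨hT.1.add hS.1, fun f => ?_⟩
  filter_upwards [hT.2 f, hS.2 f, Lp.coeFn_add (T f) (S f), hT.ae_ae_lt_top, hS.ae_ae_lt_top]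
    with x h1 h2 h3 h4 h5
  have m1 := measurable_kernel_section hT.1 x
  constructor
  · simp only [add_mul]
    rw [lintegral_add_left (by fun_prop)]
    exact ENNReal.add_lt_top.2 ⟨h1.1, h2.1⟩
  · rw [add_apply, h3, Pi.add_apply, h1.2, h2.2,
      ← integral_add (integrable_toReal_kernel hT.1 f h1.1) (integrable_toReal_kernel hS.1 f h2.1)]
    refine integral_congr_ae ?_
    filter_upwards [h4, h5] with y h4 h5
    rw [ENNReal.toReal_add h4.ne h5.ne]
    push_cast
    ring

theorem sub [SigmaFinite μ] (hT : HasENNRealKernel T κ) (hS : HasENNRealKernel S η)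
    (h : ∀ x y, η x y ≤ κ x y) :
    HasENNRealKernel (T - S) fun x y => κ x y - η x y := by
  refine ⟨hT.1.sub hS.1, fun f => ?_⟩
  filter_upwards [hT.2 f, hS.2 f, Lp.coeFn_sub (T f) (S f), hT.ae_ae_lt_top]
    with x h1 h2 h3 h4
  constructor
  · refine lt_of_le_of_lt (lintegral_mono fun y => ?_) h1.1
    gcongr
    exact tsub_le_self
  · rw [sub_apply, h3, Pi.sub_apply, h1.2, h2.2,
      ← integral_sub (integrable_toReal_kernel hT.1 f h1.1) (integrable_toReal_kernel hS.1 f h2.1)]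
    refine integral_congr_ae ?_
    filter_upwards [h4] with y h4
    rw [ENNReal.toReal_sub_of_le (h x y) h4.ne]
    push_cast
    ring

/-- The kernel of a product is the composition of the kernels (Tonelli and Fubini). -/
theorem mul [SigmaFinite μ] (hT : HasENNRealKernel T κ) (hS : HasENNRealKernel S η) :
    HasENNRealKernel (T * S) fun x y => ∫⁻ z, κ x z * η z y ∂μ := by
  refine ⟨measurable_kernel_comp hT.1 hS.1, fun f => ?_⟩
  filter_upwards [hT.2 (S (absLp f)), hT.2 (S f), hT.ae_ae_lt_top] with x h1 h2 h3
  have mx := measurable_kernel_section hT.1 x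
  have hz : ∫⁻ z, κ x z * ∫⁻ y, η z y * ‖f y‖ₑ ∂μ ∂μ < ∞ := by
    refine lt_of_le_of_lt (lintegral_mono_ae ?_) h1.1
    filter_upwards [hS.enorm_apply_absLp f] with z hz
    rw [hz]
  constructor
  · rwa [lintegral_kernel_comp mx hS.1 (measurable_coeFn_Lp f)]
  · rw [← integral_kernel_comp mx hS.1 (measurable_coeFn_Lp f) h3 hS.ae_ae_lt_top hz,
      mul_apply_eq_comp, h2.2]
    refine integral_congr_ae ?_
    filter_upwards [hS.2 f] with z hz
    rw [hz.2]

/-- A measurable kernel dominated by the kernel of a bounded operator is the kernel of a bounded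
operator. -/
theorem exists_of_le [SigmaFinite μ] (hT : HasENNRealKernel T κ)
    (hη : Measurable (Function.uncurry η)) (h : ∀ x y, η x y ≤ κ x y) :
    ∃ S : L2Operator μ, HasENNRealKernel S η := by
  have hlt : ∀ f : Lp ℂ 2 μ, ∀ᵐ x ∂μ, ∫⁻ y, η x y * ‖f y‖ₑ ∂μ < ∞ := fun f => by
    filter_upwards [hT.2 f] with x hx
    exact lt_of_le_of_lt (lintegral_mono fun y => by gcongr; exact h x y) hx.1
  -- The new operator is bounded on `f` by `T |f|`.
  have hle : ∀ f : Lp ℂ 2 μ, ∀ᵐ x ∂μ,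
      ‖∫ y, ((η x y).toReal : ℂ) * f y ∂μ‖ ≤ ‖T (absLp f) x‖ := fun f => by
    filter_upwards [hT.enorm_apply_absLp f] with x hx
    rw [← enorm_le_iff_norm_le, hx]
    refine (enorm_integral_le_lintegral_enorm _).trans (lintegral_mono fun y => ?_)
    exact (enorm_toReal_mul_le _ _).trans (by gcongr; exact h x y)
  have hmem : ∀ f : Lp ℂ 2 μ, MemLp (fun x => ∫ y, ((η x y).toReal : ℂ) * f y ∂μ) 2 μ := fun f => by
    refine (Lp.memLp (T (absLp f))).mono ?_ (hle f)
    refine AEStronglyMeasurable.integral_prod_right'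
      (f := fun p : X × X => ((η p.1 p.2).toReal : ℂ) * f p.2) ?_
    have mη : Measurable fun p : X × X => η p.1 p.2 := hη
    exact Measurable.aestronglyMeasurable (by fun_prop)
  let S : Lp ℂ 2 μ →ₗ[ℂ] Lp ℂ 2 μ :=
    { toFun := fun f => ((hmem f).toLp _)
      map_add' := fun f g => by
        refine Lp.ext ?_
        filter_upwards [(hmem (f + g)).coeFn_toLp, (hmem f).coeFn_toLp, (hmem g).coeFn_toLp,
          Lp.coeFn_add ((hmem f).toLp _) ((hmem g).toLp _), hlt f, hlt g] with x h1 h2 h3 h4 h5 h6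
        rw [h1, h4, Pi.add_apply, h2, h3, ← integral_add (integrable_toReal_kernel hη f h5)
          (integrable_toReal_kernel hη g h6)]
        refine integral_congr_ae ?_
        filter_upwards [Lp.coeFn_add f g] with y hy
        rw [hy, Pi.add_apply, mul_add]
      map_smul' := fun c f => by
        refine Lp.ext ?_
        filter_upwards [(hmem (c • f)).coeFn_toLp, (hmem f).coeFn_toLp,
          Lp.coeFn_smul c ((hmem f).toLp _)] with x h1 h2 h4
        rw [h1, RingHom.id_apply, h4, Pi.smul_apply, h2, smul_eq_mul, ← integral_const_mul]
        refine integral_congr_ae ?_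
        filter_upwards [Lp.coeFn_smul c f] with y hy
        rw [hy, Pi.smul_apply, smul_eq_mul]
        ring }
  refine ⟨S.mkContinuous ‖T‖ fun f => ?_, hη, fun f => ?_⟩
  · rw [← norm_absLp f]
    refine le_trans (Lp.norm_le_norm_of_ae_le ?_) (T.le_opNorm (absLp f))
    filter_upwards [(hmem f).coeFn_toLp, hle f] with x h1 h2
    change ‖((hmem f).toLp _) x‖ ≤ _
    rwa [h1]
  · filter_upwards [hlt f, (hmem f).coeFn_toLp] with x h1 h2
    exact ⟨h1, h2⟩

/-- Domination of kernels and of functions gives domination of the images. -/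
theorem norm_apply_le_of_le [SigmaFinite μ] (hT : HasENNRealKernel T κ)
    (hS : HasENNRealKernel S η) (h : ∀ x y, η x y ≤ κ x y) {f g : Lp ℂ 2 μ}
    (hfg : ∀ᵐ y ∂μ, ‖f y‖ ≤ ‖g y‖) : ‖S f‖ ≤ ‖T (absLp g)‖ := by
  refine Lp.norm_le_norm_of_ae_le ?_
  filter_upwards [hS.enorm_apply_le f, hT.enorm_apply_absLp g] with x h1 h2
  rw [← enorm_le_iff_norm_le, h2]
  refine h1.trans (lintegral_mono_ae ?_)
  filter_upwards [hfg] with y hy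
  gcongr
  · exact h x y
  · exact enorm_le_iff_norm_le.2 hy

theorem hasKernel (hT : HasENNRealKernel T κ) :
    HasKernel T fun p => ((κ p.1 p.2).toReal : ℂ) := by
  refine ⟨?_, fun f => ?_⟩
  · have : Measurable fun p : X × X => κ p.1 p.2 := hT.1
    exact Measurable.aestronglyMeasurable (by fun_prop)
  · filter_upwards [hT.2 f] with x hx
    exact ⟨integrable_toReal_kernel hT.1 f hx.1, hx.2⟩

end HasENNRealKernel

theorem HasKernel.hasENNRealKernel [SigmaFinite μ] {T : L2Operator μ} {k : X × X → ℝ}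
    (hT : HasKernel T fun p => (k p : ℂ)) {κ : X → X → ℝ≥0∞}
    (hκ : Measurable (Function.uncurry κ)) (hfin : ∀ x y, κ x y ≠ ∞)
    (h : ∀ᵐ p ∂μ.prod μ, k p = (κ p.1 p.2).toReal) : HasENNRealKernel T κ := by
  refine ⟨hκ, fun f => ?_⟩
  filter_upwards [hT.2 f, Measure.ae_ae_of_ae_prod h] with x hx h
  have he : (fun y => (k (x, y) : ℂ) * f y) =ᵐ[μ] fun y => ((κ x y).toReal : ℂ) * f y := by
    filter_upwards [h] with y hy
    rw [hy]
  refine ⟨?_, hx.2.trans (integral_congr_ae he)⟩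
  have := (hx.1.congr he).2
  refine lt_of_le_of_lt (lintegral_mono fun y => ?_) this
  rw [enorm_mul, ← ofReal_norm ((κ x y).toReal : ℂ)]
  simp [ENNReal.ofReal_toReal (hfin x y)]

end Kernels

section AMCompact

open Filter Topology

variable {X : Type*} [MeasurableSpace X] {μ : Measure X}

/-! ### Kernel operators are AM-compact -/

protected theorem TotallyBounded.add {E : Type*} [SeminormedAddCommGroup E] {s t : Set E}
    (hs : TotallyBounded s) (ht : TotallyBounded t) : TotallyBounded (s + t) := by
  rw [Metric.totallyBounded_iff] at *
  intro ε hε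
  obtain ⟨a, ha, hsa⟩ := hs (ε / 2) (half_pos hε)
  obtain ⟨b, hb, htb⟩ := ht (ε / 2) (half_pos hε)
  refine ⟨a + b, ha.add hb, ?_⟩
  rintro _ ⟨x, hx, y, hy, rfl⟩
  obtain ⟨u, hu, hxu⟩ := Set.mem_iUnion₂.1 (hsa hx)
  obtain ⟨v, hv, hyv⟩ := Set.mem_iUnion₂.1 (htb hy)
  refine Set.mem_iUnion₂.2 ⟨u + v, Set.add_mem_add hu hv, ?_⟩
  rw [Metric.mem_ball] at *
  calc dist (x + y) (u + v) ≤ dist x u + dist y v := dist_add_add_le _ _ _ _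
    _ < ε := by linarith

/-- An operator on `L²` is AM-compact if it maps order intervals `{f : |f| ≤ |ψ|}` to totally
bounded sets. -/
def IsAMCompact (T : L2Operator μ) : Prop :=
  ∀ ψ : Lp ℂ 2 μ, TotallyBounded (T '' {f | ∀ᵐ x ∂μ, ‖f x‖ ≤ ‖ψ x‖})

namespace IsAMCompact

variable {S T : L2Operator μ}

theorem add (hT : IsAMCompact T) (hS : IsAMCompact S) : IsAMCompact (T + S) := fun ψ => by
  refine ((hT ψ).add (hS ψ)).subset ?_
  rintro _ ⟨f, hf, rfl⟩
  exact ⟨T f, ⟨f, hf, rfl⟩, S f, ⟨f, hf, rfl⟩, rfl⟩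

theorem sub (hT : IsAMCompact T) (hS : IsAMCompact S) : IsAMCompact (T - S) := fun ψ => by
  refine ((hT ψ).add (hS ψ).neg).subset ?_
  rintro _ ⟨f, hf, rfl⟩
  exact ⟨T f, ⟨f, hf, rfl⟩, -S f, Set.neg_mem_neg.2 ⟨f, hf, rfl⟩, (sub_eq_add_neg _ _).symm⟩

/-- Uniform limits on each order interval of AM-compact operators are AM-compact. -/
theorem of_approx (h : ∀ ψ : Lp ℂ 2 μ, ∀ ε > 0, ∃ S : L2Operator μ, IsAMCompact S ∧
    ∀ f : Lp ℂ 2 μ, (∀ᵐ x ∂μ, ‖f x‖ ≤ ‖ψ x‖) → ‖T f - S f‖ < ε) : IsAMCompact T := fun ψ => by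
  rw [Metric.totallyBounded_iff]
  intro ε hε
  obtain ⟨S, hS, hTS⟩ := h ψ (ε / 2) (half_pos hε)
  obtain ⟨t, ht, hSt⟩ := Metric.totallyBounded_iff.1 (hS ψ) (ε / 2) (half_pos hε)
  refine ⟨t, ht, ?_⟩
  rintro _ ⟨f, hf, rfl⟩
  obtain ⟨u, hu, hfu⟩ := Set.mem_iUnion₂.1 (hSt ⟨f, hf, rfl⟩)
  refine Set.mem_iUnion₂.2 ⟨u, hu, ?_⟩
  have := hTS f hf
  rw [← dist_eq_norm] at this
  rw [Metric.mem_ball] at *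
  linarith [dist_triangle (T f) (S f) u]

theorem smulRight (u v : Lp ℂ 2 μ) : IsAMCompact ((innerSL ℂ u).smulRight v) := fun ψ => by
  have hc : IsCompact ((fun c : ℂ => c • v) '' Metric.closedBall 0 (‖u‖ * ‖ψ‖)) :=
    (isCompact_closedBall _ _).image (by fun_prop)
  refine hc.totallyBounded.subset ?_
  rintro _ ⟨f, hf, rfl⟩
  refine ⟨inner ℂ u f, ?_, rfl⟩
  rw [mem_closedBall_zero_iff]
  exact (norm_inner_le_norm _ _).trans (by gcongr; exact Lp.norm_le_norm_of_ae_le hf)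

end IsAMCompact

theorem enorm_sq_eq_lintegral (f : Lp ℂ 2 μ) : ‖f‖ₑ ^ 2 = ∫⁻ x, ‖f x‖ₑ ^ 2 ∂μ := by
  rw [Lp.enorm_def, eLpNorm_eq_lintegral_rpow_enorm_toReal (by simp) (by simp)]
  simp only [ENNReal.toReal_ofNat, ENNReal.rpow_ofNat]
  rw [← ENNReal.rpow_natCast, ← ENNReal.rpow_mul]
  simp

theorem hasENNRealKernel_smulRight {u v : X → ℝ≥0} (hu : Measurable u) (hv : Measurable v)
    (hu2 : ∫⁻ x, (u x : ℝ≥0∞) ^ 2 ∂μ < ∞) (hv2 : ∫⁻ x, (v x : ℝ≥0∞) ^ 2 ∂μ < ∞) :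
    HasENNRealKernel
      ((innerSL ℂ (memLp_two_of_lintegral_sq_lt_top hu hu2).toLp).smulRight
        (memLp_two_of_lintegral_sq_lt_top hv hv2).toLp) fun x y => v x * u y := by
  have m : Measurable (Function.uncurry fun x y => (v x : ℝ≥0∞) * u y) := by
    simp only [Function.uncurry_def]
    fun_prop
  set uL := (memLp_two_of_lintegral_sq_lt_top hu hu2).toLp with huL
  set vL := (memLp_two_of_lintegral_sq_lt_top hv hv2).toLp with hvL
  refine ⟨m, fun f => ?_⟩
  have hu' : ∀ᵐ y ∂μ, uL y = ((u y : ℝ) : ℂ) := MemLp.coeFn_toLp _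
  have hv' : ∀ᵐ y ∂μ, vL y = ((v y : ℝ) : ℂ) := MemLp.coeFn_toLp _
  have hi : Integrable (fun y => ((u y : ℝ) : ℂ) * f y) μ := by
    refine (L2.integrable_inner (𝕜 := ℂ) uL f).congr ?_
    filter_upwards [hu'] with y hy
    simp [hy, mul_comm]
  filter_upwards [Lp.coeFn_smul (inner ℂ uL f) vL, hv'] with x h1 h2
  constructor
  · simp only [mul_assoc]
    rw [lintegral_const_mul _ (by fun_prop)]
    refine ENNReal.mul_lt_top ENNReal.coe_lt_top (lt_of_eq_of_lt (lintegral_congr fun y => ?_) hi.2)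
    rw [enorm_mul, ← ofReal_norm ((u y : ℝ) : ℂ)]
    simp
  · change (inner ℂ uL f • vL) x = _
    rw [h1, Pi.smul_apply, h2, L2.inner_def, smul_eq_mul, ← integral_mul_const]
    refine integral_congr_ae ?_
    filter_upwards [hu'] with y hy
    simp [hy]
    ring

variable [SigmaFinite μ] {T : L2Operator μ}

/-- The remainders of an increasing sequence of kernels converge strongly to `0` on `|ψ|`, by
dominated convergence, and therefore uniformly on the order interval of `ψ`. -/
theorem HasENNRealKernel.isAMCompact_of_iSup {κ : X → X → ℝ≥0∞} (hT : HasENNRealKernel T κ)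
    {η : ℕ → X → X → ℝ≥0∞} (hη : ∀ n, Measurable (Function.uncurry (η n)))
    (hmono : ∀ x y, Monotone fun n => η n x y) (hsup : ∀ x y, ⨆ n, η n x y = κ x y)
    (h : ∀ n, ∀ S : L2Operator μ, HasENNRealKernel S (η n) → IsAMCompact S) :
    IsAMCompact T := by
  have hle : ∀ n x y, η n x y ≤ κ x y := fun n x y => by
    rw [← hsup]
    exact le_iSup (fun n => η n x y) n
  choose S hS using fun n => hT.exists_of_le (hη n) (hle n)
  refine IsAMCompact.of_approx fun ψ ε hε => ?_
  have hD : ∀ n, HasENNRealKernel (T - S n) fun x y => κ x y - η n x y :=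
    fun n => hT.sub (hS n) (hle n)
  have hlim : Tendsto (fun n => ∫⁻ x, (∫⁻ y, (κ x y - η n x y) * ‖ψ y‖ₑ ∂μ) ^ 2 ∂μ) atTop
      (𝓝 (∫⁻ x, 0 ∂μ)) := by
    refine tendsto_lintegral_of_dominated_convergence
      (fun x => (∫⁻ y, κ x y * ‖ψ y‖ₑ ∂μ) ^ 2) (fun n => ?_) (fun n => ?_) ?_ ?_
    · exact (measurable_kernel_lintegral (hD n).1 (measurable_coeFn_Lp ψ)).pow_const 2
    · refine ae_of_all _ fun x => ?_
      dsimp only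
      gcongr
      exact tsub_le_self
    · have : ∫⁻ x, (∫⁻ y, κ x y * ‖ψ y‖ₑ ∂μ) ^ 2 ∂μ = ‖T (absLp ψ)‖ₑ ^ 2 := by
        rw [enorm_sq_eq_lintegral]
        refine lintegral_congr_ae ?_
        filter_upwards [hT.enorm_apply_absLp ψ] with x hx
        rw [hx]
      rw [this]
      finiteness
    · filter_upwards [hT.2 ψ, hT.ae_ae_lt_top] with x hx htop
      have : Tendsto (fun n => ∫⁻ y, (κ x y - η n x y) * ‖ψ y‖ₑ ∂μ) atTop
          (𝓝 (∫⁻ y, 0 ∂μ)) := by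
        refine tendsto_lintegral_of_dominated_convergence
          (fun y => κ x y * ‖ψ y‖ₑ) (fun n => ?_) (fun n => ?_) hx.1.ne ?_
        · have := measurable_kernel_section (hD n).1 x
          fun_prop
        · refine ae_of_all _ fun y => ?_
          dsimp only
          gcongr
          exact tsub_le_self
        · filter_upwards [htop] with y hy
          have h1 : Tendsto (fun n => η n x y) atTop (𝓝 (κ x y)) := by
            rw [← hsup]
            exact tendsto_atTop_iSup (hmono x y)
          have h2 := ENNReal.Tendsto.sub (tendsto_const_nhds (x := κ x y)) h1 (Or.inl hy.ne)
          rw [tsub_self] at h2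
          simpa using ENNReal.Tendsto.mul_const (b := ‖ψ y‖ₑ) h2 (Or.inr enorm_ne_top)
      simpa using ENNReal.Tendsto.pow (n := 2) this
  rw [lintegral_zero] at hlim
  have hε2 : (0 : ℝ≥0∞) < ENNReal.ofReal ε ^ 2 := by positivity
  obtain ⟨n, hn⟩ := (hlim.eventually_lt_const hε2).exists
  refine ⟨S n, h n _ (hS n), fun f hf => ?_⟩
  have h1 : ‖(T - S n) (absLp ψ)‖ₑ ^ 2 < ENNReal.ofReal ε ^ 2 := by
    rw [enorm_sq_eq_lintegral]
    refine lt_of_eq_of_lt (lintegral_congr_ae ?_) hn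
    filter_upwards [(hD n).enorm_apply_absLp ψ] with x hx
    rw [hx]
  have h2 : ‖(T - S n) (absLp ψ)‖ < ε := by
    have := lt_of_not_ge fun h => h1.not_ge (pow_le_pow_left' h 2)
    rw [← ofReal_norm] at this
    exact (ENNReal.ofReal_lt_ofReal_iff hε).1 this
  exact ((hD n).norm_apply_le_of_le (hD n) (fun _ _ => le_rfl) hf).trans_lt h2

/-- Kernels of the form `g(x, y) w(x) w(y)`: density with respect to the rank one kernel
`w ⊗ w`. -/
noncomputable def weightedKernel (w : X → ℝ≥0) (g : X × X → ℝ≥0∞) (x y : X) : ℝ≥0∞ :=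
  g (x, y) * (w x * w y)

theorem measurable_weightedKernel {w : X → ℝ≥0} (hw : Measurable w) {g : X × X → ℝ≥0∞}
    (hg : Measurable g) : Measurable (Function.uncurry (weightedKernel w g)) := by
  unfold weightedKernel
  simp only [Function.uncurry_def]
  fun_prop

theorem isAMCompact_weightedKernel_add {w : X → ℝ≥0} (hw : Measurable w) {g h : X × X → ℝ≥0∞}
    (hg : Measurable g) (hh : Measurable h)
    (Pg : ∀ S : L2Operator μ, HasENNRealKernel S (weightedKernel w g) → IsAMCompact S)
    (Ph : ∀ S : L2Operator μ, HasENNRealKernel S (weightedKernel w h) → IsAMCompact S)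
    (hT : HasENNRealKernel T (weightedKernel w (g + h))) : IsAMCompact T := by
  obtain ⟨A, hA⟩ := hT.exists_of_le (measurable_weightedKernel hw hg)
    (fun x y => by unfold weightedKernel; gcongr; simp)
  obtain ⟨B, hB⟩ := hT.exists_of_le (measurable_weightedKernel hw hh)
    (fun x y => by unfold weightedKernel; gcongr; simp)
  have : T = A + B := hT.unique (by
    convert hA.add hB using 3
    simp [weightedKernel, add_mul])
  rw [this]
  exact (Pg A hA).add (Ph B hB)

theorem isAMCompact_weightedKernel_iSup {w : X → ℝ≥0} (hw : Measurable w)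
    {g : ℕ → X × X → ℝ≥0∞} (hg : ∀ n, Measurable (g n)) (hmono : Monotone g)
    (Pg : ∀ n, ∀ S : L2Operator μ, HasENNRealKernel S (weightedKernel w (g n)) → IsAMCompact S)
    (hT : HasENNRealKernel T (weightedKernel w fun p => ⨆ n, g n p)) : IsAMCompact T := by
  refine hT.isAMCompact_of_iSup (fun n => measurable_weightedKernel hw (hg n))
    (fun x y m n hmn => ?_) (fun x y => ?_) Pg
  · exact mul_le_mul_left (hmono hmn (x, y)) _
  · simp only [weightedKernel, ENNReal.iSup_mul]

/-- The case of indicator functions of measurable sets, by the `π`-`λ` theorem: measurable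
rectangles give operators of rank one. -/
theorem isAMCompact_weightedKernel_indicator {w : X → ℝ≥0} (hw : Measurable w)
    (hw2 : ∫⁻ x, (w x : ℝ≥0∞) ^ 2 ∂μ < ∞) (c : ℝ≥0) {G : Set (X × X)} (hG : MeasurableSet G) :
    ∀ S : L2Operator μ, HasENNRealKernel S (weightedKernel w (G.indicator fun _ => (c : ℝ≥0∞))) →
      IsAMCompact S := by
  have hrect : ∀ A B : Set X, MeasurableSet A → MeasurableSet B → ∃ F : L2Operator μ,
      IsAMCompact F ∧
      HasENNRealKernel F (weightedKernel w ((A ×ˢ B).indicator fun _ => (c : ℝ≥0∞))) := by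
    intro A B hA hB
    have hv2 : ∫⁻ x, ((A.indicator w x : ℝ≥0) : ℝ≥0∞) ^ 2 ∂μ < ∞ := by
      refine lt_of_le_of_lt (lintegral_mono fun x => ?_) hw2
      gcongr
      exact Set.indicator_le_self _ _ _
    have hu2 : ∫⁻ x, ((c * B.indicator w x : ℝ≥0) : ℝ≥0∞) ^ 2 ∂μ < ∞ := by
      have : ∀ x, ((c * B.indicator w x : ℝ≥0) : ℝ≥0∞) ^ 2 ≤ (c : ℝ≥0∞) ^ 2 * (w x : ℝ≥0∞) ^ 2 := by
        intro x
        rw [ENNReal.coe_mul, mul_pow]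
        gcongr
        exact Set.indicator_le_self _ _ _
      refine lt_of_le_of_lt (lintegral_mono this) ?_
      rw [lintegral_const_mul _ (by fun_prop)]
      finiteness
    have h1 := hasENNRealKernel_smulRight (u := fun y => c * B.indicator w y)
      (v := A.indicator w) (measurable_const.mul (hw.indicator hB)) (hw.indicator hA) hu2 hv2
    have h2 : (fun x y => ((A.indicator w x : ℝ≥0) : ℝ≥0∞) * ((c * B.indicator w y : ℝ≥0) : ℝ≥0∞)) =
        weightedKernel w ((A ×ˢ B).indicator fun _ => (c : ℝ≥0∞)) := by
      funext x y
      by_cases hx : x ∈ A <;> by_cases hy : y ∈ B <;> simp [weightedKernel, hx, hy]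
      ring
    exact ⟨_, IsAMCompact.smulRight _ _, h2 ▸ h1⟩
  obtain ⟨F, hF, hFk⟩ := hrect Set.univ Set.univ .univ .univ
  rw [Set.univ_prod_univ, Set.indicator_univ] at hFk
  have hmeas : ∀ {G : Set (X × X)}, MeasurableSet G →
      Measurable (G.indicator fun _ => (c : ℝ≥0∞)) := fun hG => measurable_const.indicator hG
  induction G, hG using MeasurableSpace.induction_on_inter generateFrom_prod.symm
    isPiSystem_prod with
  | empty =>
    intro S hS
    obtain ⟨F0, hF0, hF0k⟩ := hrect ∅ ∅ .empty .empty
    rw [Set.empty_prod] at hF0k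
    exact hS.unique hF0k ▸ hF0
  | basic t ht =>
    intro S hS
    obtain ⟨A, hA, B, hB, rfl⟩ := ht
    obtain ⟨F0, hF0, hF0k⟩ := hrect A B hA hB
    exact hS.unique hF0k ▸ hF0
  | compl t ht ih =>
    intro S hS
    obtain ⟨R, hR⟩ := hFk.exists_of_le (measurable_weightedKernel hw (hmeas ht)) fun x y => by
      unfold weightedKernel
      gcongr
      exact Set.indicator_le_self _ _ _
    have : S + R = F := (hS.add hR).unique (by
      convert hFk using 3 with x y
      by_cases h : (x, y) ∈ t <;> simp [weightedKernel, h])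
    rw [eq_sub_of_add_eq this]
    exact hF.sub (ih R hR)
  | iUnion f hd hf ih =>
    have hsum : ∀ n, Measurable (∑ i ∈ Finset.range n, (f i).indicator fun _ => (c : ℝ≥0∞)) :=
      fun n => Finset.sum_induction _ Measurable (fun _ _ => Measurable.add) measurable_zero
        fun i _ => hmeas (hf i)
    have hpart : ∀ n, ∀ S : L2Operator μ, HasENNRealKernel S (weightedKernel w
        (∑ i ∈ Finset.range n, (f i).indicator fun _ => (c : ℝ≥0∞))) → IsAMCompact S := by
      intro n
      induction n with
      | zero =>
        intro S hS
        obtain ⟨F0, hF0, hF0k⟩ := hrect ∅ ∅ .empty .empty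
        rw [Set.empty_prod, Set.indicator_empty] at hF0k
        exact hS.unique hF0k ▸ hF0
      | succ n ihn =>
        intro S hS
        rw [Finset.sum_range_succ] at hS
        exact isAMCompact_weightedKernel_add hw
          (hsum n) (hmeas (hf n)) ihn (ih n) hS
    intro S hS
    refine isAMCompact_weightedKernel_iSup hw
      hsum ?_ hpart ?_
    · exact monotone_nat_of_le_succ fun n => by
        rw [Finset.sum_range_succ]
        exact le_self_add
    · convert hS using 2
      funext p
      simp only [Finset.sum_apply]
      rw [← ENNReal.tsum_eq_iSup_nat]
      by_cases hp : p ∈ ⋃ i, f i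
      · obtain ⟨j, hj⟩ := Set.mem_iUnion.1 hp
        rw [Set.indicator_of_mem hp, tsum_eq_single j, Set.indicator_of_mem hj]
        intro i hij
        exact Set.indicator_of_notMem (fun hi => (Set.disjoint_left.1 (hd hij) hi) hj) _
      · rw [Set.indicator_of_notMem hp, ENNReal.tsum_eq_zero.2]
        intro i
        exact Set.indicator_of_notMem (fun hi => hp (Set.mem_iUnion.2 ⟨i, hi⟩)) _

/-- A kernel operator is AM-compact: every kernel is of the form `g(x, y) w(x) w(y)`, because `w > 0`
is finite, and `g` is approximated from below by simple functions. -/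
theorem HasENNRealKernel.isAMCompact {κ : X → X → ℝ≥0∞} (hT : HasENNRealKernel T κ) :
    IsAMCompact T := by
  obtain ⟨w, h0, hw, hw2⟩ := exists_pos_lintegral_sq_lt_top μ
  have key : ∀ g : X × X → ℝ≥0∞, Measurable g →
      ∀ S : L2Operator μ, HasENNRealKernel S (weightedKernel w g) → IsAMCompact S := by
    intro g hg
    refine Measurable.ennreal_induction (motive := fun g => ∀ S : L2Operator μ,
      HasENNRealKernel S (weightedKernel w g) → IsAMCompact S) ?_ ?_ ?_ hg
    · intro c s hs S hS
      induction c with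
      | coe c => exact isAMCompact_weightedKernel_indicator hw hw2 c hs S hS
      | top =>
        -- The constant `∞` is the supremum of the constants `n`.
        refine isAMCompact_weightedKernel_iSup hw
          (g := fun n => s.indicator fun _ => (((n : ℕ) : ℝ≥0) : ℝ≥0∞))
          (fun n => measurable_const.indicator hs) ?_
          (fun n => isAMCompact_weightedKernel_indicator hw hw2 n hs) ?_
        · intro m n hmn
          have : (((m : ℕ) : ℝ≥0) : ℝ≥0∞) ≤ ((n : ℕ) : ℝ≥0) := by exact_mod_cast hmn
          exact Set.indicator_mono fun _ => this
        · convert hS using 2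
          funext p
          by_cases hp : p ∈ s <;> simp [hp, ENNReal.iSup_natCast]
    · intro f g _ hf hg ihf ihg S hS
      exact isAMCompact_weightedKernel_add hw hf hg ihf ihg hS
    · intro f hf hmono ih S hS
      exact isAMCompact_weightedKernel_iSup hw hf hmono ih hS
  have mκ : Measurable fun p : X × X => κ p.1 p.2 := hT.1
  refine key (fun p => κ p.1 p.2 / (w p.1 * w p.2)) (by fun_prop) T ?_
  convert hT using 1
  funext x y
  have h1 : (w x * w y : ℝ≥0∞) ≠ 0 := by
    simpa using ⟨(h0 x).ne', (h0 y).ne'⟩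
  exact ENNReal.div_mul_cancel h1 (by finiteness)

end AMCompact

section GeometricMeans

variable {X : Type*} [MeasurableSpace X] {μ : Measure X}

/-! ### Weighted geometric means of kernels -/

theorem ENNReal.rpow_mul_rpow_one_sub {α : ℝ} (h0 : 0 ≤ α) (h1 : α ≤ 1) (t : ℝ≥0∞) :
    t ^ α * t ^ (1 - α) = t := by
  rw [← ENNReal.rpow_add_of_nonneg _ _ h0 (sub_nonneg.2 h1), add_sub_cancel, ENNReal.rpow_one]

theorem ENNReal.rpow_mul_rpow_one_sub_mul {α : ℝ} (h0 : 0 ≤ α) (h1 : α ≤ 1) (a b t : ℝ≥0∞) :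
    (a * t) ^ α * (b * t) ^ (1 - α) = a ^ α * b ^ (1 - α) * t := by
  rw [ENNReal.mul_rpow_of_nonneg _ _ h0, ENNReal.mul_rpow_of_nonneg _ _ (sub_nonneg.2 h1),
    mul_mul_mul_comm, ENNReal.rpow_mul_rpow_one_sub h0 h1]

/-- Hölder's inequality for sums of two terms. -/
theorem ENNReal.rpow_mul_rpow_one_sub_add_le {α : ℝ} (h0 : 0 ≤ α) (h1 : α ≤ 1)
    (a b a' b' : ℝ≥0∞) :
    a ^ α * b ^ (1 - α) + a' ^ α * b' ^ (1 - α) ≤ (a + a') ^ α * (b + b') ^ (1 - α) := by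
  have := ENNReal.lintegral_mul_norm_pow_le (μ := Measure.count)
    (measurable_of_finite ![a, a']).aemeasurable (measurable_of_finite ![b, b']).aemeasurable h0
    (sub_nonneg.2 h1) (add_sub_cancel α 1)
  simpa [lintegral_count, tsum_fintype] using this

/-- Hölder's inequality for an integral with a weight `t`. -/
theorem lintegral_rpow_mul_rpow_one_sub_mul_le {α : ℝ} (h0 : 0 ≤ α) (h1 : α ≤ 1)
    {a b c t : X → ℝ≥0∞} (ha : Measurable a) (hb : Measurable b) (ht : Measurable t)
    (hc : ∀ x, c x ≤ a x ^ α * b x ^ (1 - α)) :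
    ∫⁻ x, c x * t x ∂μ ≤ (∫⁻ x, a x * t x ∂μ) ^ α * (∫⁻ x, b x * t x ∂μ) ^ (1 - α) := by
  refine le_trans (lintegral_mono fun x => ?_) (ENNReal.lintegral_mul_norm_pow_le
    (ha.mul ht).aemeasurable (hb.mul ht).aemeasurable h0 (sub_nonneg.2 h1) (add_sub_cancel α 1))
  simp only [Pi.mul_apply]
  rw [ENNReal.rpow_mul_rpow_one_sub_mul h0 h1]
  gcongr
  exact hc x

/-- The sesquilinear form of a kernel on the moduli: `∬ κ(x, y) |f(y)| |g(x)| dμ(y) dμ(x)`. -/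
noncomputable def kernelForm (κ : X → X → ℝ≥0∞) (f g : Lp ℂ 2 μ) : ℝ≥0∞ :=
  ∫⁻ x, (∫⁻ y, κ x y * ‖f y‖ₑ ∂μ) * ‖g x‖ₑ ∂μ

theorem kernelForm_le_rpow_mul_rpow [SFinite μ] {α : ℝ} (h0 : 0 ≤ α) (h1 : α ≤ 1)
    {κ η c : X → X → ℝ≥0∞} (hκ : Measurable (Function.uncurry κ))
    (hη : Measurable (Function.uncurry η))
    (hc : ∀ x y, c x y ≤ κ x y ^ α * η x y ^ (1 - α)) (f g : Lp ℂ 2 μ) :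
    kernelForm c f g ≤ kernelForm κ f g ^ α * kernelForm η f g ^ (1 - α) :=
  lintegral_rpow_mul_rpow_one_sub_mul_le h0 h1
    (measurable_kernel_lintegral hκ (measurable_coeFn_Lp f))
    (measurable_kernel_lintegral hη (measurable_coeFn_Lp f)) (measurable_coeFn_Lp g).enorm
    fun x => lintegral_rpow_mul_rpow_one_sub_mul_le h0 h1 (measurable_kernel_section hκ x)
      (measurable_kernel_section hη x) (measurable_coeFn_Lp f).enorm (hc x)

theorem enorm_inner_complex (z w : ℂ) : ‖inner ℂ z w‖ₑ = ‖w‖ₑ * ‖z‖ₑ := by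
  rw [RCLike.inner_apply, enorm_mul]
  congr 1
  rw [← ofReal_norm, ← ofReal_norm, RCLike.norm_conj]

namespace HasENNRealKernel

variable {T : L2Operator μ} {κ : X → X → ℝ≥0∞}

theorem enorm_inner_le_kernelForm (hT : HasENNRealKernel T κ) (f g : Lp ℂ 2 μ) :
    ‖inner ℂ g (T f)‖ₑ ≤ kernelForm κ f g := by
  rw [L2.inner_def]
  refine (enorm_integral_le_lintegral_enorm _).trans (lintegral_mono_ae ?_)
  filter_upwards [hT.enorm_apply_le f] with x hx
  rw [enorm_inner_complex]
  gcongr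

theorem kernelForm_eq [SigmaFinite μ] (hT : HasENNRealKernel T κ) (f g : Lp ℂ 2 μ) :
    kernelForm κ f g = ‖inner ℂ (absLp g) (T (absLp f))‖ₑ := by
  have hfin : kernelForm κ f g < ∞ := by
    have := (L2.integrable_inner (𝕜 := ℂ) (absLp g) (T (absLp f))).2
    refine lt_of_eq_of_lt (lintegral_congr_ae ?_) this
    filter_upwards [hT.enorm_apply_absLp f, enorm_absLp_apply g] with x h1 h2
    rw [enorm_inner_complex, h1, h2]
  have hm : Measurable fun x => (∫⁻ y, κ x y * ‖f y‖ₑ ∂μ) * ‖g x‖ₑ :=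
    (measurable_kernel_lintegral hT.1 (measurable_coeFn_Lp f)).mul (measurable_coeFn_Lp g).enorm
  have : inner ℂ (absLp g) (T (absLp f)) = ((kernelForm κ f g).toReal : ℂ) := by
    rw [L2.inner_def, kernelForm,
      ← integral_toReal hm.aemeasurable (ae_lt_top hm hfin.ne), ← integral_complex_ofReal]
    refine integral_congr_ae ?_
    filter_upwards [hT.apply_absLp f, coeFn_absLp g] with x h1 h2
    rw [h1.2, h2, RCLike.inner_apply, ENNReal.toReal_mul]
    simp
  rw [this, ← ofReal_norm]
  simp [ENNReal.ofReal_toReal hfin.ne]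

end HasENNRealKernel

/-- `A`, `B` and `C` have kernels `a`, `b` and `c` with `c ≤ a ^ α * b ^ (1 - α)` pointwise. -/
def IsGeomDominated (α : ℝ) (C A B : L2Operator μ) : Prop :=
  ∃ c κ η : X → X → ℝ≥0∞, HasENNRealKernel C c ∧ HasENNRealKernel A κ ∧ HasENNRealKernel B η ∧
    ∀ x y, c x y ≤ κ x y ^ α * η x y ^ (1 - α)

theorem IsGeomDominated.zero {α : ℝ} : IsGeomDominated α (0 : L2Operator μ) 0 0 :=
  ⟨_, _, _, .zero, .zero, .zero, fun _ _ => zero_le⟩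

variable [SigmaFinite μ] {α : ℝ}

theorem IsHadamardMean.isGeomDominated {A B C : L2Operator μ} (h : IsHadamardMean α A B C)
    (h0 : 0 ≤ α) (h1 : α ≤ 1) : IsGeomDominated α C A B := by
  obtain ⟨k, l, hk, hl, hA, hB, hC⟩ := h
  have hm : ∀ {k : X × X → ℝ}, AEStronglyMeasurable (fun p => (k p : ℂ)) (μ.prod μ) →
      (∀ᵐ p ∂μ.prod μ, 0 ≤ k p) → ∃ κ : X → X → ℝ≥0∞, Measurable (Function.uncurry κ) ∧
      (∀ x y, κ x y ≠ ∞) ∧ ∀ᵐ p ∂μ.prod μ, k p = (κ p.1 p.2).toReal := by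
    intro k hk hk0
    have hk' : AEMeasurable k (μ.prod μ) := Complex.measurable_re.comp_aemeasurable hk.aemeasurable
    refine ⟨fun x y => ENNReal.ofReal (hk'.mk k (x, y)), hk'.measurable_mk.ennreal_ofReal,
      fun x y => ENNReal.ofReal_ne_top, ?_⟩
    filter_upwards [hk0, hk'.ae_eq_mk] with p h1 h2
    rw [h2] at h1
    rw [ENNReal.toReal_ofReal h1, h2]
  obtain ⟨κ, mκ, fκ, eκ⟩ := hm hA.1 hk
  obtain ⟨η, mη, fη, eη⟩ := hm hB.1 hl
  refine ⟨fun x y => κ x y ^ α * η x y ^ (1 - α), κ, η, ?_, hA.hasENNRealKernel mκ fκ eκ,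
    hB.hasENNRealKernel mη fη eη, fun x y => le_rfl⟩
  refine hC.hasENNRealKernel ((mκ.pow_const α).mul (mη.pow_const (1 - α))) (fun x y => ?_) ?_
  · exact ENNReal.mul_ne_top (ENNReal.rpow_ne_top_of_nonneg h0 (fκ x y))
      (ENNReal.rpow_ne_top_of_nonneg (sub_nonneg.2 h1) (fη x y))
  · filter_upwards [eκ, eη] with p h2 h3
    rw [h2, h3, ENNReal.toReal_mul, ENNReal.toReal_rpow, ENNReal.toReal_rpow]

namespace IsGeomDominated

variable {A B C A' B' C' : L2Operator μ}

theorem mul (h : IsGeomDominated α C A B) (h' : IsGeomDominated α C' A' B')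
    (h0 : 0 ≤ α) (h1 : α ≤ 1) : IsGeomDominated α (C * C') (A * A') (B * B') := by
  obtain ⟨c, κ, η, hC, hA, hB, hle⟩ := h
  obtain ⟨c', κ', η', hC', hA', hB', hle'⟩ := h'
  refine ⟨_, _, _, hC.mul hC', hA.mul hA', hB.mul hB', fun x y => ?_⟩
  have my : ∀ {θ : X → X → ℝ≥0∞}, Measurable (Function.uncurry θ) → Measurable fun z => θ z y :=
    fun h => h.comp (measurable_id.prodMk measurable_const)
  refine le_trans (lintegral_mono fun z => ?_) (ENNReal.lintegral_mul_norm_pow_le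
    ((measurable_kernel_section hA.1 x).mul (my hA'.1)).aemeasurable
    ((measurable_kernel_section hB.1 x).mul (my hB'.1)).aemeasurable
    h0 (sub_nonneg.2 h1) (add_sub_cancel α 1))
  simp only [Pi.mul_apply]
  rw [ENNReal.mul_rpow_of_nonneg _ _ h0, ENNReal.mul_rpow_of_nonneg _ _ (sub_nonneg.2 h1),
    mul_mul_mul_comm]
  exact mul_le_mul' (hle x z) (hle' z y)

theorem add (h : IsGeomDominated α C A B) (h' : IsGeomDominated α C' A' B')
    (h0 : 0 ≤ α) (h1 : α ≤ 1) : IsGeomDominated α (C + C') (A + A') (B + B') := by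
  obtain ⟨c, κ, η, hC, hA, hB, hle⟩ := h
  obtain ⟨c', κ', η', hC', hA', hB', hle'⟩ := h'
  exact ⟨_, _, _, hC.add hC', hA.add hA', hB.add hB', fun x y =>
    (add_le_add (hle x y) (hle' x y)).trans (ENNReal.rpow_mul_rpow_one_sub_add_le h0 h1 _ _ _ _)⟩

theorem prod_ofFn {m : ℕ} (hm : 1 ≤ m) {a b c : Fin m → L2Operator μ}
    (h : ∀ i, IsGeomDominated α (c i) (a i) (b i)) (h0 : 0 ≤ α) (h1 : α ≤ 1) :
    IsGeomDominated α (List.ofFn c).prod (List.ofFn a).prod (List.ofFn b).prod := by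
  induction m, hm using Nat.le_induction with
  | base => simpa using h 0
  | succ m hm ih =>
    simp only [List.ofFn_succ, List.prod_cons]
    exact (h 0).mul (ih fun i => h i.succ) h0 h1

theorem sum {m : ℕ} {a b c : Fin m → L2Operator μ}
    (h : ∀ i, IsGeomDominated α (c i) (a i) (b i)) (h0 : 0 ≤ α) (h1 : α ≤ 1) :
    IsGeomDominated α (∑ i, c i) (∑ i, a i) (∑ i, b i) := by
  induction m with
  | zero => simpa using zero
  | succ m ih =>
    simp only [Fin.sum_univ_succ]
    exact (h 0).add (ih fun i => h i.succ) h0 h1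

/-- The geometric mean of two kernels is dominated by their sum, so that the Hadamard mean exists
as a bounded operator. -/
theorem exists_isHadamardMean (h : IsGeomDominated α C A B) (h0 : 0 ≤ α) (h1 : α ≤ 1) :
    ∃ D : L2Operator μ, IsHadamardMean α A B D ∧ IsGeomDominated α C D D := by
  obtain ⟨c, κ, η, hC, hA, hB, hle⟩ := h
  obtain ⟨D, hD⟩ := (hA.add hB).exists_of_le
    (η := fun x y => κ x y ^ α * η x y ^ (1 - α))
    ((hA.1.pow_const α).mul (hB.1.pow_const (1 - α))) fun x y => by
      calc κ x y ^ α * η x y ^ (1 - α)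
          ≤ (κ x y + η x y) ^ α * (κ x y + η x y) ^ (1 - α) :=
            mul_le_mul' (ENNReal.rpow_le_rpow le_self_add h0)
              (ENNReal.rpow_le_rpow le_add_self (sub_nonneg.2 h1))
        _ = κ x y + η x y := ENNReal.rpow_mul_rpow_one_sub h0 h1 _
  refine ⟨D, ⟨fun p => (κ p.1 p.2).toReal, fun p => (η p.1 p.2).toReal,
    .of_forall fun _ => ENNReal.toReal_nonneg, .of_forall fun _ => ENNReal.toReal_nonneg,
    hA.hasKernel, hB.hasKernel, ?_⟩, c, _, _, hC, hD, hD, fun x y => ?_⟩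
  · simpa only [ENNReal.toReal_mul, ENNReal.toReal_rpow] using hD.hasKernel
  · rw [ENNReal.rpow_mul_rpow_one_sub h0 h1]
    exact hle x y

/-! ### Operator norm and numerical radius of geometric means -/

/-- Bounds for `A` and `B` on the functions supported in `E` combine to a bound for `C` on these
functions. -/
theorem enorm_apply_le (h : IsGeomDominated α C A B) (h0 : 0 ≤ α) (h1 : α ≤ 1) {E : Set X}
    {a b : ℝ≥0∞} (ha : ∀ f : Lp ℂ 2 μ, (∀ᵐ x ∂μ, x ∉ E → f x = 0) → ‖A f‖ₑ ≤ a * ‖f‖ₑ)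
    (hb : ∀ f : Lp ℂ 2 μ, (∀ᵐ x ∂μ, x ∉ E → f x = 0) → ‖B f‖ₑ ≤ b * ‖f‖ₑ)
    (f : Lp ℂ 2 μ) (hf : ∀ᵐ x ∂μ, x ∉ E → f x = 0) :
    ‖C f‖ₑ ≤ a ^ α * b ^ (1 - α) * ‖f‖ₑ := by
  obtain ⟨c, κ, η, hC, hA, hB, hle⟩ := h
  have habs : ∀ᵐ x ∂μ, x ∉ E → absLp f x = 0 := by
    filter_upwards [hf, coeFn_absLp f] with x h1 h2 hx
    simp [h2, h1 hx]
  have hn : ∀ g : Lp ℂ 2 μ, ‖absLp g‖ₑ = ‖g‖ₑ := fun g => by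
    rw [← ofReal_norm, norm_absLp, ofReal_norm]
  have form : ∀ {T : L2Operator μ} {θ : X → X → ℝ≥0∞} {t : ℝ≥0∞}, HasENNRealKernel T θ →
      ‖T (absLp f)‖ₑ ≤ t * ‖absLp f‖ₑ → kernelForm θ f (C f) ≤ t * (‖f‖ₑ * ‖C f‖ₑ) := by
    intro T θ t hT ht
    rw [hT.kernelForm_eq, ← hn f, ← hn (C f), ← mul_assoc, mul_comm]
    refine le_trans ?_ (mul_le_mul_right ht _)
    rw [← ofReal_norm, ← ofReal_norm, ← ofReal_norm, ← ENNReal.ofReal_mul (norm_nonneg _)]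
    exact ENNReal.ofReal_le_ofReal (norm_inner_le_norm _ _)
  -- Test the form against `g = C f`, and cancel one factor `‖C f‖`.
  have key : ‖C f‖ₑ * ‖C f‖ₑ ≤ a ^ α * b ^ (1 - α) * ‖f‖ₑ * ‖C f‖ₑ := calc
    ‖C f‖ₑ * ‖C f‖ₑ = ‖inner ℂ (C f) (C f)‖ₑ := by
        rw [inner_self_eq_norm_sq_to_K, ← ofReal_norm, ← ENNReal.ofReal_mul (norm_nonneg _),
          ← ofReal_norm]
        simp [sq]
    _ ≤ kernelForm c f (C f) := hC.enorm_inner_le_kernelForm f (C f)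
    _ ≤ kernelForm κ f (C f) ^ α * kernelForm η f (C f) ^ (1 - α) :=
        kernelForm_le_rpow_mul_rpow h0 h1 hA.1 hB.1 hle _ _
    _ ≤ (a * (‖f‖ₑ * ‖C f‖ₑ)) ^ α * (b * (‖f‖ₑ * ‖C f‖ₑ)) ^ (1 - α) :=
        mul_le_mul' (ENNReal.rpow_le_rpow (form hA (ha _ habs)) h0)
          (ENNReal.rpow_le_rpow (form hB (hb _ habs)) (sub_nonneg.2 h1))
    _ = a ^ α * b ^ (1 - α) * ‖f‖ₑ * ‖C f‖ₑ := by
        rw [ENNReal.rpow_mul_rpow_one_sub_mul h0 h1, ← mul_assoc]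
  by_cases hz : ‖C f‖ₑ = 0
  · rw [hz]
    exact zero_le
  · exact (ENNReal.mul_le_mul_iff_left hz enorm_ne_top).1 key

theorem opNorm_le (h : IsGeomDominated α C A B) (h0 : 0 ≤ α) (h1 : α ≤ 1) :
    ‖C‖ₑ ≤ ‖A‖ₑ ^ α * ‖B‖ₑ ^ (1 - α) := by
  refine C.opENorm_le_bound fun f => ?_
  exact h.enorm_apply_le h0 h1 (E := Set.univ) (fun f _ => A.le_opENorm f)
    (fun f _ => B.le_opENorm f) f (by simp)

theorem numRadius_le (h : IsGeomDominated α C A B) (h0 : 0 ≤ α) (h1 : α ≤ 1) :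
    numRadius C ≤ numRadius A ^ α * numRadius B ^ (1 - α) := by
  obtain ⟨c, κ, η, hC, hA, hB, hle⟩ := h
  refine iSup_le fun ⟨f, hf⟩ => ?_
  have form : ∀ {T : L2Operator μ} {θ : X → X → ℝ≥0∞}, HasENNRealKernel T θ →
      kernelForm θ f f ≤ numRadius T := by
    intro T θ hT
    rw [hT.kernelForm_eq]
    exact le_iSup (fun f : {f : Lp ℂ 2 μ // ‖f‖ = 1} => ‖inner ℂ (f : Lp ℂ 2 μ) (T f)‖ₑ)
      ⟨absLp f, (norm_absLp f).trans hf⟩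
  calc ‖inner ℂ f (C f)‖ₑ ≤ kernelForm c f f := hC.enorm_inner_le_kernelForm f f
    _ ≤ kernelForm κ f f ^ α * kernelForm η f f ^ (1 - α) :=
        kernelForm_le_rpow_mul_rpow h0 h1 hA.1 hB.1 hle _ _
    _ ≤ _ := mul_le_mul' (ENNReal.rpow_le_rpow (form hA) h0)
          (ENNReal.rpow_le_rpow (form hB) (sub_nonneg.2 h1))

end IsGeomDominated

end GeometricMeans

section Noncompactness

open Filter Topology

variable {X : Type*} [MeasurableSpace X] {μ : Measure X}

/-! ### The Hausdorff measure of non-compactness -/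

theorem mem_add_smul_closedBall_iff {E : Type*} [NormedAddCommGroup E] [NormedSpace ℝ E]
    {M : Set E} {δ : ℝ≥0} {y : E} :
    y ∈ M + (δ : ℝ) • Metric.closedBall (0 : E) 1 ↔ ∃ m ∈ M, ‖y - m‖ ≤ δ := by
  rw [smul_unitClosedBall_of_nonneg δ.coe_nonneg]
  constructor
  · rintro ⟨m, hm, z, hz, rfl⟩
    exact ⟨m, hm, by simpa using hz⟩
  · rintro ⟨m, hm, h⟩
    exact ⟨m, hm, y - m, by simpa using h, add_sub_cancel _ _⟩

theorem hausdorffNoncompactness_le_of_totallyBounded {T : L2Operator μ} {d : ℝ≥0}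
    {K : Set (Lp ℂ 2 μ)} (hK : TotallyBounded K)
    (h : ∀ f : Lp ℂ 2 μ, ‖f‖ ≤ 1 → ∃ k ∈ K, ‖T f - k‖ ≤ d) : hausdorffNoncompactness T ≤ d := by
  refine ENNReal.le_of_forall_pos_le_add fun ε hε _ => sInf_le ?_
  obtain ⟨M, hM, hKM⟩ := Metric.totallyBounded_iff.1 hK ε hε
  refine ⟨d + ε, by positivity, by simp, M, hM, ?_⟩
  rintro _ ⟨f, hf, rfl⟩
  obtain ⟨k, hk, hfk⟩ := h f (by simpa using hf)
  obtain ⟨m, hm, hkm⟩ := Set.mem_iUnion₂.1 (hKM hk)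
  refine mem_add_smul_closedBall_iff.2 ⟨m, hm, ?_⟩
  rw [Metric.mem_ball, dist_eq_norm] at hkm
  calc ‖T f - m‖ ≤ ‖T f - k‖ + ‖k - m‖ := norm_sub_le_norm_sub_add_norm_sub _ _ _
    _ ≤ (d + ε : ℝ≥0) := by push_cast; linarith

theorem exists_finite_net_of_hausdorffNoncompactness_lt {T : L2Operator μ} {d : ℝ≥0}
    (h : hausdorffNoncompactness T < d) :
    ∃ M : Set (Lp ℂ 2 μ), M.Finite ∧ ∀ f : Lp ℂ 2 μ, ‖f‖ ≤ 1 → ∃ m ∈ M, ‖T f - m‖ ≤ d := by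
  obtain ⟨_, ⟨δ, -, rfl, M, hM, hTM⟩, hδ⟩ := sInf_lt_iff.1 h
  refine ⟨M, hM, fun f hf => ?_⟩
  obtain ⟨m, hm, hfm⟩ := mem_add_smul_closedBall_iff.1 (hTM ⟨f, by simpa using hf, rfl⟩)
  exact ⟨m, hm, hfm.trans (by exact_mod_cast hδ.le)⟩

theorem hausdorffNoncompactness_ne_top (T : L2Operator μ) : hausdorffNoncompactness T ≠ ∞ := by
  refine ne_top_of_le_ne_top (ENNReal.coe_ne_top (r := ‖T‖₊))
    (hausdorffNoncompactness_le_of_totallyBounded (totallyBounded_singleton 0) fun f hf => ?_)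
  refine ⟨0, rfl, ?_⟩
  rw [sub_zero]
  exact T.unit_le_opNorm f hf

theorem hausdorffNoncompactness_adjoint_le (T : L2Operator μ) :
    hausdorffNoncompactness (ContinuousLinearMap.adjoint T) ≤ hausdorffNoncompactness T := by
  refine le_of_forall_gt_imp_ge_of_dense fun c hc => ?_
  obtain ⟨d, hTd, hdc⟩ := ENNReal.lt_iff_exists_nnreal_btwn.1 hc
  refine le_trans ?_ hdc.le
  obtain ⟨M, hM, hTM⟩ := exists_finite_net_of_hausdorffNoncompactness_lt hTd
  -- `P` is the orthogonal projection onto the span of the net: `‖T - P T‖ ≤ d`, so that the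
  -- adjoint `T†` is within `d` of the finite rank operator `T† P`.
  have hV : FiniteDimensional ℂ (Submodule.span ℂ M) := FiniteDimensional.span_of_finite ℂ hM
  set V := Submodule.span ℂ M
  set P : L2Operator μ := V.starProjection
  have h1 : ‖T - P * T‖ ≤ d := by
    refine ContinuousLinearMap.opNorm_le_of_unit_norm d.coe_nonneg fun f hf => ?_
    obtain ⟨m, hm, hfm⟩ := hTM f hf.le
    refine le_trans ?_ hfm
    have := V.starProjection_minimal (T f)
    change ‖T f - V.starProjection (T f)‖ ≤ _
    rw [this]
    exact ciInf_le (f := fun x : V => ‖T f - x‖) ⟨0, by rintro _ ⟨x, rfl⟩; positivity⟩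
      ⟨m, Submodule.subset_span hm⟩
  have h2 : ‖ContinuousLinearMap.adjoint T - ContinuousLinearMap.adjoint T * P‖ ≤ d := by
    have hP : star P = P := isSelfAdjoint_starProjection V
    have : ContinuousLinearMap.adjoint T - ContinuousLinearMap.adjoint T * P =
        star (T - P * T) := by
      rw [star_sub, star_mul, hP]
      rfl
    rw [this, norm_star]
    exact h1
  have hK : IsCompact ((fun v : V => ContinuousLinearMap.adjoint T v) ''
      Metric.closedBall (0 : V) 1) := by
    have := FiniteDimensional.proper ℂ V
    exact (isCompact_closedBall _ _).image (by fun_prop)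
  refine hausdorffNoncompactness_le_of_totallyBounded hK.totallyBounded fun g hg => ?_
  refine ⟨_, ⟨V.orthogonalProjectionOnto g, ?_, rfl⟩, ?_⟩
  · rw [mem_closedBall_zero_iff]
    exact (V.norm_orthogonalProjectionOnto_apply_le g).trans hg
  · exact (ContinuousLinearMap.unit_le_opNorm _ g hg).trans h2

theorem hausdorffNoncompactness_adjoint (T : L2Operator μ) :
    hausdorffNoncompactness (ContinuousLinearMap.adjoint T) = hausdorffNoncompactness T :=
  le_antisymm (hausdorffNoncompactness_adjoint_le T)
    (by simpa using hausdorffNoncompactness_adjoint_le (ContinuousLinearMap.adjoint T))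

/-- Integrals over small sets are small, where smallness is measured by the density `w ^ 2`. -/
theorem exists_pos_setLIntegral_lt_of_setLIntegral_sq_lt {w : X → ℝ≥0} (h0 : ∀ x, 0 < w x)
    (hw : Measurable w) {G : X → ℝ≥0∞} (hG : Measurable G) (hfin : ∫⁻ x, G x ∂μ ≠ ∞)
    {κ : ℝ≥0∞} (hκ : κ ≠ 0) :
    ∃ ε > 0, ∀ E, MeasurableSet E → ∫⁻ x in E, (w x : ℝ≥0∞) ^ 2 ∂μ < ε →
      ∫⁻ x in E, G x ∂μ < κ := by
  have hw' : Measurable fun x => (w x : ℝ≥0∞) ^ 2 := by fun_prop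
  have hcancel : ∀ x, (w x : ℝ≥0∞) ^ 2 * (G x / (w x : ℝ≥0∞) ^ 2) = G x := fun x =>
    ENNReal.mul_div_cancel (by simpa using (h0 x).ne') (by finiteness)
  have heq : ∀ ν : Measure X, ∫⁻ x, G x / (w x : ℝ≥0∞) ^ 2
      ∂ν.withDensity (fun x => (w x : ℝ≥0∞) ^ 2) = ∫⁻ x, G x ∂ν := fun ν => by
    rw [lintegral_withDensity_eq_lintegral_mul _ hw' (by fun_prop)]
    simp only [Pi.mul_apply, hcancel]
  obtain ⟨ε, hε, h⟩ := exists_pos_setLIntegral_lt_of_measure_lt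
    (μ := μ.withDensity fun x => (w x : ℝ≥0∞) ^ 2) (f := fun x => G x / (w x : ℝ≥0∞) ^ 2)
    (by rwa [heq]) hκ
  refine ⟨ε, hε, fun E hE hlt => ?_⟩
  have := h E (by rwa [withDensity_apply _ hE])
  rwa [restrict_withDensity hE, heq] at this

theorem norm_inner_le_of_support {E : Set X} (hE : MeasurableSet E) {f g : Lp ℂ 2 μ}
    (hf : ∀ᵐ x ∂μ, x ∉ E → f x = 0) {κ : ℝ} (hκ : 0 ≤ κ)
    (hg : ∫⁻ x in E, ‖g x‖ₑ ^ 2 ∂μ ≤ ENNReal.ofReal κ ^ 2) : ‖inner ℂ g f‖ ≤ κ * ‖f‖ := by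
  have hmem : MemLp (E.indicator g) 2 μ := (Lp.memLp g).indicator hE
  have heq : inner ℂ g f = inner ℂ hmem.toLp f := by
    rw [L2.inner_def, L2.inner_def]
    refine integral_congr_ae ?_
    filter_upwards [hf, hmem.coeFn_toLp] with x h1 h2
    by_cases hx : x ∈ E
    · simp [h2, hx]
    · simp [h1 hx]
  have hn : ‖hmem.toLp‖ ≤ κ := by
    have : ‖hmem.toLp‖ₑ ^ 2 ≤ ENNReal.ofReal κ ^ 2 := by
      refine le_trans (le_of_eq ?_) hg
      rw [enorm_sq_eq_lintegral, ← lintegral_indicator hE]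
      refine lintegral_congr_ae ?_
      filter_upwards [hmem.coeFn_toLp] with x hx
      rw [hx]
      by_cases hx : x ∈ E <;> simp [hx]
    have := (ENNReal.pow_le_pow_left_iff two_ne_zero).1 this
    rw [← ofReal_norm] at this
    exact (ENNReal.ofReal_le_ofReal_iff hκ).1 this
  rw [heq]
  exact (norm_inner_le_norm _ _).trans (by gcongr)

/-- A bounded operator has norm at most `d > γ(T)` on the functions supported in a sufficiently
small set. -/
theorem exists_pos_enorm_apply_le_of_hausdorffNoncompactness_lt {w : X → ℝ≥0} (h0 : ∀ x, 0 < w x)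
    (hw : Measurable w) {T : L2Operator μ} {d : ℝ≥0} (h : hausdorffNoncompactness T < d) :
    ∃ ε > 0, ∀ E, MeasurableSet E → ∫⁻ x in E, (w x : ℝ≥0∞) ^ 2 ∂μ < ε →
      ∀ f : Lp ℂ 2 μ, (∀ᵐ x ∂μ, x ∉ E → f x = 0) → ‖T f‖ₑ ≤ d * ‖f‖ₑ := by
  obtain ⟨d', hTd', hd'⟩ := ENNReal.lt_iff_exists_nnreal_btwn.1 h
  have hd : (d' : ℝ) < d := by exact_mod_cast hd'
  obtain ⟨M, hM, hTM⟩ := exists_finite_net_of_hausdorffNoncompactness_lt hTd'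
  have hd'0 := d'.coe_nonneg
  have hκ : 0 < (d : ℝ) * (d - d') := mul_pos (by linarith) (by linarith)
  -- With `t = ‖T f‖` and `‖f‖ ≤ 1`, pairing `T f` with itself and with a nearby net point gives
  -- `t² ≤ d (d - d') + d' t`, which forces `t ≤ d`.
  obtain ⟨ε, hε, hεE⟩ := exists_pos_setLIntegral_lt_of_setLIntegral_sq_lt (μ := μ) h0 hw
    (G := fun x => ∑ m ∈ hM.toFinset, ‖ContinuousLinearMap.adjoint T m x‖ₑ ^ 2)
    (κ := ENNReal.ofReal (d * (d - d')) ^ 2) (by fun_prop)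
    (by
      rw [lintegral_finsetSum _ (by fun_prop)]
      simp only [← enorm_sq_eq_lintegral]
      exact ENNReal.sum_ne_top.2 fun m _ => by finiteness)
    (by positivity)
  refine ⟨ε, hε, fun E hE hlt => ?_⟩
  have hunit : ∀ f : Lp ℂ 2 μ, ‖f‖ ≤ 1 → (∀ᵐ x ∂μ, x ∉ E → f x = 0) → ‖T f‖ ≤ d := by
    intro f hf1 hf
    obtain ⟨m, hm, hfm⟩ := hTM f hf1
    have hG : ∫⁻ x in E, ‖ContinuousLinearMap.adjoint T m x‖ₑ ^ 2 ∂μ ≤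
        ENNReal.ofReal (d * (d - d')) ^ 2 := by
      refine le_trans (lintegral_mono fun x => ?_) (hεE E hE hlt).le
      exact Finset.single_le_sum (f := fun m => ‖ContinuousLinearMap.adjoint T m x‖ₑ ^ 2)
        (fun _ _ => zero_le) (hM.mem_toFinset.2 hm)
    have h1 := norm_inner_le_of_support hE hf hκ.le hG
    rw [ContinuousLinearMap.adjoint_inner_left] at h1
    have h2 : ‖T f‖ ^ 2 ≤ d * (d - d') + d' * ‖T f‖ := by
      have e : inner ℂ (T f) (T f) = inner ℂ m (T f) + inner ℂ (T f - m) (T f) := by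
        rw [inner_sub_left, add_sub_cancel]
      have e1 : ‖T f‖ ^ 2 = ‖inner ℂ (T f) (T f)‖ := by
        rw [inner_self_eq_norm_sq_to_K]
        simp
      rw [e1, e]
      refine (norm_add_le _ _).trans (add_le_add (h1.trans (mul_le_of_le_one_right hκ.le hf1)) ?_)
      exact (norm_inner_le_norm _ _).trans (by gcongr)
    by_contra! hlt
    nlinarith
  intro f hf
  have hreal : ‖T f‖ ≤ d * ‖f‖ := by
    rcases eq_or_ne f 0 with rfl | hne
    · simp
    have hn : 0 < ‖f‖ := norm_pos_iff.2 hne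
    have := hunit (((‖f‖⁻¹ : ℝ) : ℂ) • f) (by
      rw [norm_smul]
      simp [hn.ne']) (by
      filter_upwards [hf, Lp.coeFn_smul ((‖f‖⁻¹ : ℝ) : ℂ) f] with x h1 h2 hx
      rw [h2, Pi.smul_apply, h1 hx, smul_zero])
    rw [map_smul, norm_smul] at this
    simp only [Complex.norm_real, norm_inv, norm_norm] at this
    rwa [inv_mul_le_iff₀ hn, mul_comm] at this
  rw [← ofReal_norm, ← ofReal_norm, ← ENNReal.ofReal_coe_nnreal,
    ← ENNReal.ofReal_mul d.coe_nonneg]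
  exact ENNReal.ofReal_le_ofReal hreal

variable [SigmaFinite μ]

/-- For a kernel operator, a norm bound on the functions supported in small sets bounds the measure
of non-compactness: every `f` in the unit ball is the sum of a function in a fixed order interval,
and of a function supported in the small set where `|f|` is large compared to `w`. -/
theorem HasENNRealKernel.hausdorffNoncompactness_le {T : L2Operator μ} {κ : X → X → ℝ≥0∞}
    (hT : HasENNRealKernel T κ) {w : X → ℝ≥0} (hw : Measurable w)
    (hw2 : ∫⁻ x, (w x : ℝ≥0∞) ^ 2 ∂μ < ∞) {ε : ℝ≥0∞} (hε : 0 < ε) {d : ℝ≥0}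
    (h : ∀ E, MeasurableSet E → ∫⁻ x in E, (w x : ℝ≥0∞) ^ 2 ∂μ < ε →
      ∀ f : Lp ℂ 2 μ, (∀ᵐ x ∂μ, x ∉ E → f x = 0) → ‖T f‖ₑ ≤ d * ‖f‖ₑ) :
    hausdorffNoncompactness T ≤ d := by
  obtain ⟨n, hn⟩ := ENNReal.exists_inv_nat_lt hε.ne'
  -- The order interval is that of `ψ = √n w`, and `n ∫_{|f| > ψ} w² dμ ≤ ‖f‖² ≤ 1`.
  have hψm : Measurable fun x => NNReal.sqrt n * w x := by fun_prop
  have hsq : ∀ x, ((NNReal.sqrt n * w x : ℝ≥0) : ℝ≥0∞) ^ 2 = n * (w x : ℝ≥0∞) ^ 2 := fun x => by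
    rw [← ENNReal.coe_pow, mul_pow, NNReal.sq_sqrt]
    simp
  have hψ2 : ∫⁻ x, ((NNReal.sqrt n * w x : ℝ≥0) : ℝ≥0∞) ^ 2 ∂μ < ∞ := by
    simp only [hsq]
    rw [lintegral_const_mul _ (by fun_prop)]
    finiteness
  set ψ := (memLp_two_of_lintegral_sq_lt_top hψm hψ2).toLp
  refine hausdorffNoncompactness_le_of_totallyBounded (hT.isAMCompact ψ) fun f hf => ?_
  set E : Set X := {x | (n : ℝ≥0∞) * (w x : ℝ≥0∞) ^ 2 < ‖f x‖ₑ ^ 2}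
  have hE : MeasurableSet E := measurableSet_lt (by fun_prop) (by fun_prop)
  have hEε : ∫⁻ x in E, (w x : ℝ≥0∞) ^ 2 ∂μ < ε := by
    refine lt_of_le_of_lt ?_ hn
    rw [ENNReal.le_inv_iff_mul_le, mul_comm, ← lintegral_const_mul _ (by fun_prop)]
    calc ∫⁻ x in E, n * (w x : ℝ≥0∞) ^ 2 ∂μ ≤ ∫⁻ x in E, ‖f x‖ₑ ^ 2 ∂μ :=
          setLIntegral_mono (by fun_prop) fun x hx => le_of_lt hx
      _ ≤ ∫⁻ x, ‖f x‖ₑ ^ 2 ∂μ := setLIntegral_le_lintegral _ _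
      _ = ‖f‖ₑ ^ 2 := (enorm_sq_eq_lintegral f).symm
      _ ≤ 1 := pow_le_one₀ zero_le (by
          rw [← ofReal_norm]
          exact ENNReal.ofReal_le_one.2 hf)
  have hmem : MemLp (E.indicator f) 2 μ := (Lp.memLp f).indicator hE
  have hind := hmem.coeFn_toLp
  have hsub := Lp.coeFn_sub f hmem.toLp
  refine ⟨T (f - hmem.toLp), ⟨f - hmem.toLp, ?_, rfl⟩, ?_⟩
  · filter_upwards [hind, hsub, (memLp_two_of_lintegral_sq_lt_top hψm hψ2).coeFn_toLp]
      with x h1 h2 h3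
    rw [h2, Pi.sub_apply, h1, h3]
    by_cases hx : x ∈ E
    · rw [Set.indicator_of_mem hx, sub_self, norm_zero]
      exact norm_nonneg _
    · have hx' : ‖f x‖ₑ ^ 2 ≤ ((NNReal.sqrt n * w x : ℝ≥0) : ℝ≥0∞) ^ 2 := by
        rw [hsq]
        exact not_lt.1 hx
      have := (ENNReal.pow_le_pow_left_iff two_ne_zero).1 hx'
      rw [enorm_le_coe] at this
      have : ‖f x‖ ≤ (NNReal.sqrt n * w x : ℝ≥0) := this
      rw [Set.indicator_of_notMem hx, sub_zero, Complex.norm_real]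
      exact this.trans (le_abs_self _)
  · rw [← map_sub, sub_sub_cancel]
    have h1 := h E hE hEε hmem.toLp (by
      filter_upwards [hind] with x hx hxE
      rw [hx, Set.indicator_of_notMem hxE])
    have h2 : ‖hmem.toLp‖ ≤ 1 := by
      refine (Lp.norm_le_norm_of_ae_le ?_).trans hf
      filter_upwards [hind] with x hx
      rw [hx]
      exact norm_indicator_le_norm_self _ _
    have h3 : ‖T hmem.toLp‖ₑ ≤ d := by
      refine h1.trans (mul_le_of_le_one_right zero_le ?_)
      rw [← ofReal_norm]
      exact ENNReal.ofReal_le_one.2 h2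
    exact enorm_le_coe.1 h3

theorem IsGeomDominated.hausdorffNoncompactness_le {α : ℝ} {A B C : L2Operator μ}
    (h : IsGeomDominated α C A B) (h0 : 0 ≤ α) (h1 : α ≤ 1) :
    hausdorffNoncompactness C ≤
      hausdorffNoncompactness A ^ α * hausdorffNoncompactness B ^ (1 - α) := by
  obtain ⟨w, hw0, hw, hw2⟩ := exists_pos_lintegral_sq_lt_top μ
  have hα := sub_nonneg.2 h1
  have key : ∀ a b : ℝ≥0, hausdorffNoncompactness A < a → hausdorffNoncompactness B < b →
      hausdorffNoncompactness C ≤ (a ^ α * b ^ (1 - α) : ℝ≥0) := by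
    intro a b ha hb
    obtain ⟨ε, hε, hA⟩ := exists_pos_enorm_apply_le_of_hausdorffNoncompactness_lt hw0 hw ha
    obtain ⟨ε', hε', hB⟩ := exists_pos_enorm_apply_le_of_hausdorffNoncompactness_lt hw0 hw hb
    have h' := h
    obtain ⟨c, -, -, hC, -⟩ := h'
    refine hC.hausdorffNoncompactness_le hw hw2 (lt_min hε hε') fun E hE hEε f hf => ?_
    rw [ENNReal.coe_mul, ENNReal.coe_rpow_of_nonneg _ h0, ENNReal.coe_rpow_of_nonneg _ hα]
    exact h.enorm_apply_le h0 h1 (hA E hE (hEε.trans_le (min_le_left _ _)))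
      (hB E hE (hEε.trans_le (min_le_right _ _))) f hf
  obtain ⟨p, hp⟩ : ∃ p : ℝ≥0, (p : ℝ≥0∞) = hausdorffNoncompactness A :=
    ⟨_, ENNReal.coe_toNNReal (hausdorffNoncompactness_ne_top A)⟩
  obtain ⟨q, hq⟩ : ∃ q : ℝ≥0, (q : ℝ≥0∞) = hausdorffNoncompactness B :=
    ⟨_, ENNReal.coe_toNNReal (hausdorffNoncompactness_ne_top B)⟩
  rw [← hp, ← hq] at key ⊢
  rw [← ENNReal.coe_rpow_of_nonneg _ h0, ← ENNReal.coe_rpow_of_nonneg _ hα, ← ENNReal.coe_mul]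
  have hlim : Tendsto (fun t : ℝ≥0 => (((p + t) ^ α * (q + t) ^ (1 - α) : ℝ≥0) : ℝ≥0∞)) (𝓝[>] 0)
      (𝓝 (((p + 0) ^ α * (q + 0) ^ (1 - α) : ℝ≥0) : ℝ≥0∞)) := by
    refine (Continuous.tendsto ?_ 0).mono_left nhdsWithin_le_nhds
    exact ENNReal.continuous_coe.comp
      (((NNReal.continuous_rpow_const h0).comp (by fun_prop)).mul
        ((NNReal.continuous_rpow_const hα).comp (by fun_prop)))
  rw [add_zero, add_zero] at hlim
  refine ge_of_tendsto hlim ?_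
  filter_upwards [self_mem_nhdsWithin] with t ht
  have ht : 0 < t := ht
  exact key _ _ (by exact_mod_cast lt_add_of_pos_right p ht)
    (by exact_mod_cast lt_add_of_pos_right q ht)

end Noncompactness

section OperatorSets

variable {X : Type*} [MeasurableSpace X] {μ : Measure X}

/-! ### Sets of operators -/

theorem adjoint_prod_ofFn_rev {m : ℕ} (b : Fin m → L2Operator μ) :
    ContinuousLinearMap.adjoint (List.ofFn fun i => b i.rev).prod =
      (List.ofFn fun i => ContinuousLinearMap.adjoint (b i)).prod := by
  change star (List.ofFn fun i => b i.rev).prod = (List.ofFn fun i => star (b i)).prod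
  induction m with
  | zero => simp
  | succ m ih =>
    rw [List.ofFn_succ', List.ofFn_succ]
    simp only [List.concat_eq_append, List.prod_append, List.prod_cons, List.prod_nil, mul_one,
      star_mul, Fin.rev_last, Fin.rev_castSucc]
    rw [ih fun i => b i.succ]

theorem numRadius_adjoint (T : L2Operator μ) :
    numRadius (ContinuousLinearMap.adjoint T) = numRadius T := by
  refine iSup_congr fun f => ?_
  rw [ContinuousLinearMap.adjoint_inner_right, ← ofReal_norm, ← ofReal_norm, norm_inner_symm]

variable [SigmaFinite μ] {α : ℝ}

/-- The inequalities hold for the supremum over sets of any function `r` on operators that is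
invariant under adjoints and submultiplicative for geometric means. Monotonicity of `r` with respect
to kernels is the case `A = B` of the second property. -/
theorem iSup_geomSymm_inequalities (h0 : 0 ≤ α) (h1 : α ≤ 1) {r : L2Operator μ → ℝ≥0∞}
    (hr : ∀ A B C : L2Operator μ, IsGeomDominated α C A B → r C ≤ r A ^ α * r B ^ (1 - α))
    (hadj : ∀ A : L2Operator μ, r (ContinuousLinearMap.adjoint A) = r A)
    {m : ℕ} (hm : 1 ≤ m) (Ψ : Fin m → Set (L2Operator μ)) :
    ((⨆ A ∈ setProd fun i => geomSymm α (Ψ i), r A) ≤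
        ⨆ A ∈ hadamardMeanSet α (setProd Ψ) (adjointSet (setProd fun i => Ψ i.rev)), r A) ∧
    ((⨆ A ∈ hadamardMeanSet α (setProd Ψ) (adjointSet (setProd fun i => Ψ i.rev)), r A) ≤
        (⨆ A ∈ setProd Ψ, r A) ^ α * (⨆ A ∈ setProd fun i => Ψ i.rev, r A) ^ (1 - α)) ∧
    ((⨆ A ∈ setSum fun i => geomSymm α (Ψ i), r A) ≤ ⨆ A ∈ geomSymm α (setSum Ψ), r A) ∧
    (⨆ A ∈ geomSymm α (setSum Ψ), r A) ≤ ⨆ A ∈ setSum Ψ, r A := by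
  have hmono : ∀ {C D : L2Operator μ}, IsGeomDominated α C D D → r C ≤ r D := fun h => by
    simpa only [ENNReal.rpow_mul_rpow_one_sub h0 h1] using hr _ _ _ h
  have hmean : ∀ Φ Θ : Set (L2Operator μ), (⨆ A ∈ hadamardMeanSet α Φ (adjointSet Θ), r A) ≤
      (⨆ A ∈ Φ, r A) ^ α * (⨆ A ∈ Θ, r A) ^ (1 - α) := by
    intro Φ Θ
    refine iSup₂_le ?_
    rintro C ⟨A, hA, _, ⟨B, hB, rfl⟩, hC⟩
    refine (hr _ _ _ (hC.isGeomDominated h0 h1)).trans ?_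
    dsimp only
    rw [hadj]
    exact mul_le_mul' (ENNReal.rpow_le_rpow (le_iSup₂ (f := fun A _ => r A) A hA) h0)
      (ENNReal.rpow_le_rpow (le_iSup₂ (f := fun B _ => r B) B hB) (sub_nonneg.2 h1))
  refine ⟨iSup₂_le ?_, hmean _ _, iSup₂_le ?_, ?_⟩
  · rintro _ ⟨c, hc, rfl⟩
    choose a ha b' hb' hC using hc
    choose b hb hbb' using hb'
    obtain rfl : (fun i => ContinuousLinearMap.adjoint (b i)) = b' := funext hbb'
    obtain ⟨D, hD, hCD⟩ := (IsGeomDominated.prod_ofFn hm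
      (fun i => (hC i).isGeomDominated h0 h1) h0 h1).exists_isHadamardMean h0 h1
    refine (hmono hCD).trans (le_iSup₂ (f := fun A _ => r A) D ?_)
    exact ⟨_, ⟨a, ha, rfl⟩, _, ⟨_, ⟨fun i => b i.rev, fun i => hb i.rev, rfl⟩,
      adjoint_prod_ofFn_rev b⟩, hD⟩
  · rintro _ ⟨c, hc, rfl⟩
    choose a ha b' hb' hC using hc
    choose b hb hbb' using hb'
    obtain rfl : (fun i => ContinuousLinearMap.adjoint (b i)) = b' := funext hbb'
    obtain ⟨D, hD, hCD⟩ := (IsGeomDominated.sum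
      (fun i => (hC i).isGeomDominated h0 h1) h0 h1).exists_isHadamardMean h0 h1
    refine (hmono hCD).trans (le_iSup₂ (f := fun A _ => r A) D ?_)
    exact ⟨_, ⟨a, ha, rfl⟩, _, ⟨_, ⟨b, hb, rfl⟩, map_sum _ _ _⟩, hD⟩
  · exact (hmean _ _).trans_eq (ENNReal.rpow_mul_rpow_one_sub h0 h1 _)

end OperatorSets

theorem corollary3p2 {X : Type*} [MeasurableSpace X] (μ : Measure X) [SigmaFinite μ]
    (m : ℕ) (hm : 1 ≤ m) (Ψ : Fin m → Set (L2Operator μ))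
    (hbdd : ∀ i, Bornology.IsBounded (Ψ i))
    (hker : ∀ i, ∀ A ∈ Ψ i, IsPositiveKernelOperator A)
    (α : ℝ) (hα : α ∈ Set.Icc (0 : ℝ) 1)
    (ρ : Set (L2Operator μ) → ℝ≥0∞)
    (hρ : ρ = setNorm ∨ ρ = setNoncompactness ∨ ρ = setNumRadius) :
    (ρ (setProd fun i => geomSymm α (Ψ i)) ≤
        ρ (hadamardMeanSet α (setProd Ψ) (adjointSet (setProd fun i => Ψ i.rev))) ∧
      ρ (hadamardMeanSet α (setProd Ψ) (adjointSet (setProd fun i => Ψ i.rev))) ≤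
        ρ (setProd Ψ) ^ α * ρ (setProd fun i => Ψ i.rev) ^ (1 - α)) ∧
    (ρ (setSum fun i => geomSymm α (Ψ i)) ≤ ρ (geomSymm α (setSum Ψ)) ∧
      ρ (geomSymm α (setSum Ψ)) ≤ ρ (setSum Ψ)) := by
  obtain ⟨h0, h1⟩ := hα
  rw [and_assoc]
  rcases hρ with rfl | rfl | rfl
  · exact iSup_geomSymm_inequalities (r := fun A => ‖A‖ₑ) h0 h1 (fun _ _ _ h => h.opNorm_le h0 h1)
      (fun A => by rw [← ofReal_norm, LinearIsometryEquiv.norm_map, ofReal_norm]) hm Ψ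
  · exact iSup_geomSymm_inequalities h0 h1 (fun _ _ _ h => h.hausdorffNoncompactness_le h0 h1)
      hausdorffNoncompactness_adjoint hm Ψ
  · exact iSup_geomSymm_inequalities h0 h1 (fun _ _ _ h => h.numRadius_le h0 h1)
      numRadius_adjoint hm Ψ
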